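/- Let $n\ge 1$ and $0\le m\le\lfloor n/2\rfloor$ be integers. For a tuple $b=(b_0,\dots,b_m)$ of complex numbers let $B=B_{(n-m,m)}$ be the complex matrix whose rows and columns are indexed by the $m$-element subsets of $\{1,\dots,n\}$ and whose entry at $(\sigma,\tau)$ is $b_p$ with $p=\#(\sigma\cap\tau)$. It acts on the space $M^{(n-m,m)}$ with standard basis the $m$-element subsets. For $0\le k\le m$ let $T_k$ be the tableau of shape $(n-k,k)$ with first row $1,\dots,n-k$ and second row $n-k+1,\dots,n$, let $R(T_k),C(T_k)\subseteq S_n$ be its row and column subgroups, let $c_k=\Big(\sum_{q\in C(T_k)}\operatorname{sgn}(q)\,q\Big)\Big(\sum_{p\in R(T_k)}p\Big)\in\mathbb C[S_n]$ be the Young symmetrizer, and let $f^{(n-k,k)}$ be the dimension of the Specht module $S^{(n-k,k)}=\mathbb C[S_n]\,c_k$. Let $\Omega=\{n-m+1,\dots,n\}$ and let $\pi:\mathbb C[S_n]\to M^{(n-m,m)}$ be the linear map with $\pi(p)=p(\Omega)$ for $p\in S_n$. Put $$\lambda_k=\lambda_k(b)=\sum_{j=0}^{k}\sum_{p=0}^{m-k}(-1)^{k-j}\binom{k}{j}\binom{m-j}{p}\binom{n-m-k+j}{m-k-p}\,b_{j+p}.$$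 (1) For every $b\in\mathbb C^{m+1}$ and every $0\le k\le m$, the vector $\pi(c_k)$ is nonzero and $B\,\pi(c_k)=\lambda_k\,\pi(c_k)$. (2) For generic $b$ (that is, for all $b$ at which a certain nonzero polynomial in $b_0,\dots,b_m$, depending only on $n$ and $m$, does not vanish) the numbers $\lambda_0,\dots,\lambda_m$ are pairwise distinct, and each $\lambda_k$ has both geometric and algebraic multiplicity $f^{(n-k,k)}$ as an eigenvalue of $B$. (3) For every $b$, multiplicities add up when eigenvalues coincide: the characteristic polynomial of $B$ is $\prod_{k=0}^m (X-\lambda_k)^{f^{(n-k,k)}}$, and the $\lambda_k$-eigenspace of $B$ has dimension $\sum_{0\le l\le m,\ \lambda_l=\lambda_k} f^{(n-l,l)}$. (4) For $0\le k\le m$, $f^{(n-k,k)}=\dfrac{n!\,(n-2k+1)}{k!\,(n-k+1)!}=\dbinom{n}{k}-\dbinom{n}{k-1}$, where $\binom{n}{-1}=0$. -/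

import Mathlib

namespace SubsetRep

open Equiv

/-- The group algebra `ℂ[S_n]`, with `S_n` the permutations of `Fin n`
(entries `1, …, n` of tableaux are written `0, …, n - 1`). -/
abbrev GroupAlg (n : ℕ) : Type := MonoidAlgebra ℂ (Perm (Fin n))

/-- Underlying space of the permutation module `M^{(n-m,m)}`: complex functions on the
`m`-subsets of an `n`-set, written in coordinates for the standard basis. -/
abbrev PermMod (n m : ℕ) : Type := Set.powersetCard (Fin n) m → ℂ

/-- The universal intertwining matrix `B_{(n-m,m)}`: its entry at `(σ, τ)` is `b p`, where
`p` is the cardinality of `σ ∩ τ`.  Only `b 0, …, b m` occur. -/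
def intertwiner (n m : ℕ) (b : ℕ → ℂ) :
    Matrix (Set.powersetCard (Fin n) m) (Set.powersetCard (Fin n) m) ℂ :=
  Matrix.of fun σ τ => b ((σ : Finset (Fin n)) ∩ (τ : Finset (Fin n))).card

/-- Row index of the entry `i` in the tableau `T_k` of shape `(n-k,k)`, numbered
lexicographically: first row `0, …, n-k-1`, second row `n-k, …, n-1`. -/
def rowIdx (n k : ℕ) (i : Fin n) : ℕ := if (i : ℕ) < n - k then 0 else 1

/-- Column index of the entry `i` in the tableau `T_k`. -/
def colIdx (n k : ℕ) (i : Fin n) : ℕ := if (i : ℕ) < n - k then i else i - (n - k)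

/-- The subgroup of permutations that preserve every fibre of `f`. -/
def fibreSubgroup {n : ℕ} (f : Fin n → ℕ) : Subgroup (Perm (Fin n)) where
  carrier := {p | ∀ i, f (p i) = f i}
  mul_mem' {p q} hp hq i := (hp (q i)).trans (hq i)
  one_mem' _ := rfl
  inv_mem' {p} hp i := by simpa using (hp (p⁻¹ i)).symm

/-- The row subgroup `R(T_k)`. -/
def rowSubgroup (n k : ℕ) : Subgroup (Perm (Fin n)) := fibreSubgroup (rowIdx n k)

/-- The column subgroup `C(T_k)`. -/
def colSubgroup (n k : ℕ) : Subgroup (Perm (Fin n)) := fibreSubgroup (colIdx n k)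

open Classical in
/-- `a_k`, the sum of the row subgroup. -/
noncomputable def rowSum (n k : ℕ) : GroupAlg n :=
  ∑ p : Perm (Fin n) with p ∈ rowSubgroup n k, MonoidAlgebra.single p 1

open Classical in
/-- `b_k`, the signed sum of the column subgroup. -/
noncomputable def colSum (n k : ℕ) : GroupAlg n :=
  ∑ q : Perm (Fin n) with q ∈ colSubgroup n k,
    MonoidAlgebra.single q (((Perm.sign q : ℤˣ) : ℤ) : ℂ)

/-- The Young symmetrizer `c_k = b_k a_k` of the tableau `T_k`. -/
noncomputable def youngSymm (n k : ℕ) : GroupAlg n := colSum n k * rowSum n k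

/-- The Specht module `S^{(n-k,k)}`: the image of right multiplication by `c_k` on `ℂ[S_n]`. -/
noncomputable def specht (n k : ℕ) : Submodule ℂ (GroupAlg n) :=
  LinearMap.range (LinearMap.mulRight ℂ (youngSymm n k))

/-- `f^{(n-k,k)}`, the dimension of the Specht module. -/
noncomputable def spechtDim (n k : ℕ) : ℕ := Module.finrank ℂ (specht n k)

/-- The last `m`-subset `{n-m, …, n-1}` of `Fin n`. -/
def lastSubset (n m : ℕ) (hm : m ≤ n) : Set.powersetCard (Fin n) m :=
  Set.powersetCard.ofCard (s := Finset.univ.filter fun i : Fin n => n - m ≤ (i : ℕ)) (by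
    have h := Fin.card_filter_val_lt (n := n) (m := n - m)
    have h2 := Finset.card_filter_add_card_filter_not (s := (Finset.univ : Finset (Fin n)))
      (fun i : Fin n => (i : ℕ) < n - m)
    simp only [not_lt, Finset.card_univ, Fintype.card_fin] at h2
    omega)

open Classical in
/-- The linear map `π : ℂ[S_n] → M^{(n-m,m)}` with `π p = p Ω`, where `Ω` is the last
`m`-subset. -/
noncomputable def proj (n m : ℕ) (hm : m ≤ n) : GroupAlg n →ₗ[ℂ] PermMod n m :=
  Finsupp.linearCombination ℂ
      (fun p : Perm (Fin n) => (Pi.single (p • lastSubset n m hm) 1 : PermMod n m)) ∘ₗ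
    (MonoidAlgebra.coeffLinearEquiv ℂ).toLinearMap

/-- The eigenvalue `λ_k`.  All natural number subtractions are genuine for `k ≤ m ≤ n / 2`. -/
def eigval (n m k : ℕ) (b : ℕ → ℂ) : ℂ :=
  ∑ j ∈ Finset.range (k + 1), ∑ p ∈ Finset.range (m - k + 1),
    (-1) ^ (k - j) * (k.choose j : ℂ) * ((m - j).choose p : ℂ) *
      ((n - m - k + j).choose (m - k - p) : ℂ) * b (j + p)

end SubsetRep

namespace SubsetRep
open Equiv
open scoped Pointwise

/-! Up to a nonzero factor, `π(c_k)` is the function `polytabloid`: a signed sum over the sets `S`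
of columns of length two of `T_k`, where the permutation swapping the columns in `S` is applied to
the indicator of "contains the second row `L`". For any `τ`, the alternating sum over `S` of `g(#(qτ
∩ L))`, with `q` the swap belonging to `S`, equals `polytabloid τ` times the `k`-th difference of
`g` at `0` (`sum_powerset_card_inter`), because each column contributes `0` or `±` one difference.
In `B π(c_k)` the column permutations can be moved from the summation variable to `τ`. The remaining
sum depends only on `#(qτ ∩ L)`, and its `k`-th difference is `λ_k`.

Since `B` commutes with `S_n`, it acts by `λ_k` on the whole image of the Specht module
`S^{(n-k,k)}`. The map `π` is injective on that module (`proj_injOn_specht`). The images for `k ≤ m`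
span (`iSup_spechtImage`): a functional killing all of them has vanishing superset sums on `k`-sets,
by induction on `k`, and for `k = m` these sums are its coordinates. They are independent because
one particular `b`, that of the Johnson graph, makes the `λ_k` distinct. So a single basis,
independent of `b`, diagonalizes every `B`, which gives the characteristic polynomial and the
eigenspaces. The same `b` shows that the product of the differences `λ_k - λ_l` is a nonzero
polynomial.

Comparing dimensions gives `∑_{k ≤ m} f^{(n-k,k)} = n.choose m`, and subtracting consecutive cases
gives the formula for `f`. -/

/-! ### Combinatorics of finite sets and alternating sums -/

/-- With `E` the shift operator, the left side is `∏ (E^(u i) - E^(l i))` applied to `h` at `0`, and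
each factor is `0` or `±(E - 1)`. So `ε` is the product of the `u i - l i`. The point is that it
does not depend on `h`. -/
theorem exists_sum_powerset_neg_one_pow {ι : Type*} [DecidableEq ι] (s : Finset ι) (u l : ι → ℕ)
    (hu : ∀ i ∈ s, u i ≤ 1) (hl : ∀ i ∈ s, l i ≤ 1) :
    ∃ ε : ℂ, ∀ h : ℕ → ℂ,
      ∑ S ∈ s.powerset, (-1) ^ S.card * h (∑ i ∈ s \ S, u i + ∑ i ∈ S, l i) =
        ε * ∑ S ∈ s.powerset, (-1) ^ S.card * h (s \ S).card := by
  induction s using Finset.induction_on with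
  | empty => exact ⟨1, fun h => by simp⟩
  | insert a s ha ih =>
    obtain ⟨ε, hε⟩ := ih (fun i hi => hu i (by simp [hi])) (fun i hi => hl i (by simp [hi]))
    have key : ∀ (u l : ι → ℕ) (h : ℕ → ℂ),
        ∑ S ∈ (insert a s).powerset,
          (-1) ^ S.card * h (∑ i ∈ insert a s \ S, u i + ∑ i ∈ S, l i) =
        ∑ S ∈ s.powerset, (-1) ^ S.card * (h (u a + (∑ i ∈ s \ S, u i + ∑ i ∈ S, l i)) -
          h (l a + (∑ i ∈ s \ S, u i + ∑ i ∈ S, l i))) := by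
      intro u l h
      rw [Finset.sum_powerset_insert ha, ← Finset.sum_add_distrib]
      refine Finset.sum_congr rfl fun S hS => ?_
      have haS : a ∉ S := fun h => ha (Finset.mem_powerset.1 hS h)
      rw [Finset.insert_sdiff_of_notMem _ haS, Finset.sum_insert (by simp [ha]),
        Finset.insert_sdiff_insert, Finset.sdiff_insert_of_notMem ha, Finset.sum_insert haS,
        Finset.card_insert_of_notMem haS, pow_succ, add_assoc, add_left_comm (l a)]
      ring
    -- The right-hand side is the same kind of sum with `u = 1` and `l = 0`, so the same recursion
    -- applies to it.
    have hr : ∀ h : ℕ → ℂ, ∑ S ∈ (insert a s).powerset, (-1) ^ S.card * h (insert a s \ S).card =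
        ∑ S ∈ s.powerset, (-1) ^ S.card * (h (1 + (s \ S).card) - h (s \ S).card) := by
      intro h
      simpa using key (fun _ => 1) (fun _ => 0) h
    have hua := hu a (by simp)
    have hla := hl a (by simp)
    simp only [key, hr]
    have hε' := fun h : ℕ → ℂ => hε (fun x => h (u a + x) - h (l a + x))
    rcases Nat.le_one_iff_eq_zero_or_eq_one.1 hua with h1 | h1 <;>
      rcases Nat.le_one_iff_eq_zero_or_eq_one.1 hla with h2 | h2
    · exact ⟨0, fun h => by simp [h1, h2]⟩
    · refine ⟨-ε, fun h => ?_⟩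
      rw [hε' h, h1, h2, neg_mul, ← mul_neg, ← Finset.sum_neg_distrib]
      congr 1
      refine Finset.sum_congr rfl fun S _ => ?_
      rw [zero_add]; ring
    · refine ⟨ε, fun h => ?_⟩
      rw [hε' h, h1, h2]
      simp
    · exact ⟨0, fun h => by simp [h1, h2]⟩

theorem card_filter_powersetCard_card_inter {α : Type*} [DecidableEq α] {X T : Finset α}
    (hT : T ⊆ X) {r p : ℕ} (hp : p ≤ r) :
    ((X.powersetCard r).filter fun Y => (Y ∩ T).card = p).card =
      T.card.choose p * (X \ T).card.choose (r - p) := by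
  rw [← Finset.card_powersetCard, ← Finset.card_powersetCard, ← Finset.card_product]
  refine Finset.card_bij' (fun Y _ => (Y ∩ T, Y \ T)) (fun Q _ => Q.1 ∪ Q.2) ?_ ?_ ?_ ?_
  · intro Y hY
    simp only [Finset.mem_filter, Finset.mem_powersetCard, Finset.mem_product] at hY ⊢
    refine ⟨⟨Finset.inter_subset_right, hY.2⟩, Finset.sdiff_subset_sdiff hY.1.1 le_rfl, ?_⟩
    have := Finset.card_inter_add_card_sdiff Y T
    omega
  · rintro ⟨A, B⟩ hQ
    simp only [Finset.mem_filter, Finset.mem_powersetCard, Finset.mem_product] at hQ ⊢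
    obtain ⟨⟨hA, hAc⟩, hB, hBc⟩ := hQ
    have hd : Disjoint A B := (Finset.disjoint_sdiff.mono_left hA).mono_right hB
    refine ⟨⟨Finset.union_subset (hA.trans hT) (hB.trans Finset.sdiff_subset), ?_⟩, ?_⟩
    · rw [Finset.card_union_of_disjoint hd]; omega
    · rw [Finset.union_inter_distrib_right, Finset.inter_eq_left.2 hA,
        Finset.disjoint_iff_inter_eq_empty.1 (Finset.disjoint_sdiff.symm.mono_left hB),
        Finset.union_empty, hAc]
  · intro Y _
    exact sup_comm (Y ∩ T) _ |>.trans (Finset.sdiff_union_inter Y T)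
  · rintro ⟨A, B⟩ hQ
    simp only [Finset.mem_powersetCard, Finset.mem_product] at hQ
    obtain ⟨⟨hA, -⟩, hB, -⟩ := hQ
    ext x
    · have := @hA x; have := @hB x; simp at *; tauto
    · have := @hA x; have := @hB x; simp at *; tauto

theorem sum_powersetCard_card_inter {α : Type*} [DecidableEq α] {X T : Finset α}
    (hT : T ⊆ X) (r : ℕ) (f : ℕ → ℂ) :
    ∑ Y ∈ X.powersetCard r, f (Y ∩ T).card =
      ∑ p ∈ Finset.range (r + 1),
        (T.card.choose p : ℂ) * ((X \ T).card.choose (r - p) : ℂ) * f p := by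
  rw [← Finset.sum_fiberwise_of_maps_to (s := X.powersetCard r) (t := Finset.range (r + 1))
    (g := fun Y => (Y ∩ T).card)]
  · refine Finset.sum_congr rfl fun p hp => ?_
    rw [Finset.sum_congr rfl (g := fun _ => f p) fun Y hY => by rw [(Finset.mem_filter.1 hY).2],
      Finset.sum_const, card_filter_powersetCard_card_inter hT (by simpa [Nat.lt_succ_iff] using hp)]
    simp
  · intro Y hY
    have := (Finset.mem_powersetCard.1 hY).2
    have := Finset.card_le_card (Finset.inter_subset_left (s₁ := Y) (s₂ := T))
    simp; omega

/-- By Pascal's rule each difference of `x ↦ x.choose r` lowers `r` by one. -/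
theorem sum_range_neg_one_pow_choose_choose (k N r : ℕ) (hk : k ≤ r) :
    ∑ j ∈ Finset.range (k + 1), (-1 : ℂ) ^ (k - j) * (k.choose j : ℂ) * ((N + j).choose r : ℂ) =
      (N.choose (r - k) : ℂ) := by
  have h := fwdDiff_iter_eq_sum_shift (1 : ℕ) (fun x : ℕ => (x.choose r : ℤ)) k N
  obtain ⟨t, rfl⟩ := Nat.exists_eq_add_of_le' hk
  rw [add_comm t k, fwdDiff_iter_choose] at h
  have h' := congrArg (Int.cast : ℤ → ℂ) h
  push_cast at h'
  rw [add_comm t k, Nat.add_sub_cancel_left, h']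
  refine Finset.sum_congr rfl fun j _ => ?_
  simp

/-- Exchange some `a ∈ σ \ τ` with some `b ∈ τ \ σ` and induct on `#(σ \ τ)`; equal traces on `Z`
keep `a` and `b` outside `Z`. With `Z` the second row of `T_k`, this makes the row group transitive
on the `m`-sets containing that row. -/
theorem exists_perm_smul_eq {α : Type*} [DecidableEq α] (Z : Finset α) {σ τ : Finset α}
    (hc : σ.card = τ.card) (hZ : σ ∩ Z = τ ∩ Z) :
    ∃ p : Perm α, (∀ z ∈ Z, p z = z) ∧ p • σ = τ := by
  induction hd : (σ \ τ).card generalizing σ with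
  | zero =>
    have : σ ⊆ τ := Finset.sdiff_eq_empty_iff_subset.1 (Finset.card_eq_zero.1 hd)
    exact ⟨1, by simp, by rw [one_smul]; exact Finset.eq_of_subset_of_card_le this hc.ge⟩
  | succ d ih =>
    obtain ⟨a, ha⟩ : (σ \ τ).Nonempty := Finset.card_pos.1 (by omega)
    obtain ⟨b, hb⟩ : (τ \ σ).Nonempty := by
      rw [← Finset.card_pos, ← (Finset.card_sdiff_comm hc)]; omega
    rw [Finset.mem_sdiff] at ha hb
    have haZ : a ∉ Z := fun h => ha.2 (Finset.mem_inter.1 (hZ ▸ Finset.mem_inter.2 ⟨ha.1, h⟩)).1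
    have hbZ : b ∉ Z := fun h => hb.2 (Finset.mem_inter.1 (hZ ▸ Finset.mem_inter.2 ⟨hb.1, h⟩)).1
    have hmem : ∀ x, x ∈ swap a b • σ ↔ (x ≠ a ∧ x ∈ σ) ∨ x = b := by
      intro x
      rw [← Finset.inv_smul_mem_iff, Equiv.swap_inv, Perm.smul_def]
      rcases eq_or_ne x a with rfl | hxa
      · simp [hb.2]; rintro rfl; exact hb.2 ha.1
      · rcases eq_or_ne x b with rfl | hxb
        · simp [ha.1]
        · simp [swap_apply_of_ne_of_ne hxa hxb, hxa, hxb]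
    obtain ⟨p, hp, hpσ⟩ := @ih (swap a b • σ) (by simpa using hc) (by
      rw [← hZ]
      ext x
      rw [Finset.mem_inter, Finset.mem_inter, hmem]
      constructor
      · rintro ⟨h | rfl, h2⟩
        · exact ⟨h.2, h2⟩
        · exact absurd h2 hbZ
      · rintro ⟨h1, h2⟩
        exact ⟨Or.inl ⟨fun h => haZ (h ▸ h2), h1⟩, h2⟩) (by
      have : (swap a b • σ) \ τ = (σ \ τ).erase a := by
        ext x
        rw [Finset.mem_sdiff, hmem, Finset.mem_erase, Finset.mem_sdiff]
        constructor
        · rintro ⟨h | rfl, h2⟩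
          · exact ⟨h.1, h.2, h2⟩
          · exact absurd hb.1 h2
        · rintro ⟨h1, h2, h3⟩
          exact ⟨Or.inl ⟨h1, h2⟩, h3⟩
      rw [this, Finset.card_erase_of_mem (Finset.mem_sdiff.2 ha)]; omega)
    refine ⟨p * swap a b, fun z hz => ?_, by rw [mul_smul, hpσ]⟩
    rw [Perm.mul_apply, swap_apply_of_ne_of_ne (ne_of_mem_of_not_mem hz haZ)
      (ne_of_mem_of_not_mem hz hbZ), hp z hz]

/-- An elementary form of the fact that the kernel of the map to `(k-1)`-sets meets the orthogonal
complement of all polytabloids trivially. For `x ≠ y`, the function `ρ ↦ h(ρ ∪ {x}) - h(ρ ∪ {y})` on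
`X` minus `{x, y}` satisfies the hypotheses one level down, hence vanishes. So `h(ρ ∪ {c})` does not
depend on `c`, and the sum condition forces it to be `0`. -/
theorem eq_zero_of_sum_insert_eq_zero_of_differences {α : Type*} [DecidableEq α]
    [Nonempty α] (k : ℕ) (X : Finset α) (h : Finset α → ℂ) (hX : 2 * k ≤ X.card)
    (hD : ∀ ρ ⊆ X, ρ.card + 1 = k → ∑ c ∈ X \ ρ, h (insert c ρ) = 0)
    (hdiff : ∀ a b : ℕ → α, Set.InjOn a (Finset.range k) → Set.InjOn b (Finset.range k) →
      (∀ i < k, ∀ j < k, a i ≠ b j) → (∀ i < k, a i ∈ X ∧ b i ∈ X) →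
      ∑ S ∈ (Finset.range k).powerset,
        (-1) ^ S.card * h ((Finset.range k \ S).image a ∪ S.image b) = 0)
    (A : Finset α) (hA : A ⊆ X) (hAk : A.card = k) : h A = 0 := by
  induction k generalizing X h A with
  | zero =>
    obtain rfl := Finset.card_eq_zero.1 hAk
    simpa using hdiff (fun _ => Classical.arbitrary α) (fun _ => Classical.arbitrary α)
  | succ k ih =>
    have hpair : ∀ x ∈ X, ∀ y ∈ X, x ≠ y → ∀ ρ ⊆ X, x ∉ ρ → y ∉ ρ → ρ.card = k →
        h (insert x ρ) - h (insert y ρ) = 0 := by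
      intro x hx y hy hxy ρ hρX hxρ hyρ hρ
      have hXc : ((X.erase x).erase y).card + 2 = X.card := by
        rw [Finset.card_erase_of_mem (by simp [hy, hxy.symm]), Finset.card_erase_of_mem hx]
        omega
      refine ih ((X.erase x).erase y) (fun ρ => h (insert x ρ) - h (insert y ρ)) (by omega) ?_ ?_ ρ
        ?_ hρ
      · intro ρ hρX hρk
        have hx' : x ∉ ρ := fun h => by simpa using hρX h
        have hy' : y ∉ ρ := fun h => by simpa using hρX h
        have hρX' : ρ ⊆ X := hρX.trans ((Finset.erase_subset _ _).trans (Finset.erase_subset _ _))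
        -- Isolating the term `c = y` in the sum condition at `ρ ∪ {x}` leaves `-h(ρ ∪ {x, y})`,
        -- which is symmetric in `x` and `y` and so cancels in the difference.
        have aux : ∀ x ∈ X, ∀ y ∈ X, x ≠ y → x ∉ ρ → y ∉ ρ →
            ∑ c ∈ ((X.erase x).erase y) \ ρ, h (insert x (insert c ρ)) =
              - h (insert x (insert y ρ)) := by
          intro x hx y hy hxy hxρ hyρ
          have h0 := hD (insert x ρ) (Finset.insert_subset hx hρX')
            (by rw [Finset.card_insert_of_notMem hxρ, hρk])
          have : X \ insert x ρ = insert y (((X.erase x).erase y) \ ρ) := by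
            ext c
            simp only [Finset.mem_sdiff, Finset.mem_insert, Finset.mem_erase]
            by_cases hc : c = y
            · subst hc; simp [hy, hxy.symm, hyρ]
            · tauto
          rw [this, Finset.sum_insert (by simp)] at h0
          rw [Finset.insert_comm x y, eq_neg_iff_add_eq_zero, add_comm, ← h0]
          congr 1
          exact Finset.sum_congr rfl fun c _ => by rw [Finset.insert_comm]
        rw [Finset.sum_sub_distrib, aux x hx y hy hxy hx' hy', Finset.erase_right_comm,
          aux y hy x hx hxy.symm hy' hx', Finset.insert_comm x y, sub_self]
      · intro a b ha hb hab hmem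
        have hlt : ∀ i ∈ Finset.range k, i ≠ k := fun i hi => (Finset.mem_range.1 hi).ne
        have himg : ∀ (f : ℕ → α) (z : α), ∀ S ⊆ Finset.range k,
            S.image (Function.update f k z) = S.image f := by
          intro f z S hS
          exact Finset.image_congr fun i hi => Function.update_of_ne (hlt i (hS hi)) _ _
        have hinj : ∀ (f : ℕ → α) (z : α), Set.InjOn f (Finset.range k) → (∀ i < k, f i ≠ z) →
            Set.InjOn (Function.update f k z) (Finset.range (k + 1)) := by
          intro f z hf hz i hi j hj hij
          simp only [Finset.coe_range, Set.mem_Iio] at hi hj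
          rcases Nat.lt_succ_iff_lt_or_eq.1 hi with hi | rfl <;>
            rcases Nat.lt_succ_iff_lt_or_eq.1 hj with hj | rfl
          · rw [Function.update_of_ne hi.ne, Function.update_of_ne hj.ne] at hij
            exact hf (by simpa using hi) (by simpa using hj) hij
          · rw [Function.update_of_ne hi.ne, Function.update_self] at hij
            exact absurd hij (hz i hi)
          · rw [Function.update_of_ne hj.ne, Function.update_self] at hij
            exact absurd hij.symm (hz j hj)
          · rfl
        have hmem' : ∀ i < k, (a i ≠ y ∧ a i ≠ x ∧ a i ∈ X) ∧ (b i ≠ y ∧ b i ≠ x ∧ b i ∈ X) := by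
          intro i hi; simpa using hmem i hi
        -- The pair `(x, y)` is appended as an extra column. Splitting subsets of `range (k + 1)` by
        -- whether they contain `k` yields the difference of the two values of `h`.
        have h0 := hdiff (Function.update a k x) (Function.update b k y)
          (hinj a x ha fun i hi => (hmem' i hi).1.2.1) (hinj b y hb fun i hi => (hmem' i hi).2.1)
          (by
            intro i hi j hj
            rcases Nat.lt_succ_iff_lt_or_eq.1 hi with hi | rfl <;>
              rcases Nat.lt_succ_iff_lt_or_eq.1 hj with hj | rfl
            · rw [Function.update_of_ne hi.ne, Function.update_of_ne hj.ne]; exact hab i hi j hj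
            · rw [Function.update_of_ne hi.ne, Function.update_self]; exact (hmem' i hi).1.1
            · rw [Function.update_of_ne hj.ne, Function.update_self]
              exact (hmem' j hj).2.2.1.symm
            · simpa using hxy)
          (by
            intro i hi
            rcases Nat.lt_succ_iff_lt_or_eq.1 hi with hi | rfl
            · rw [Function.update_of_ne hi.ne, Function.update_of_ne hi.ne]
              exact ⟨(hmem' i hi).1.2.2, (hmem' i hi).2.2.2⟩
            · simpa using ⟨hx, hy⟩)
        rw [Finset.range_add_one, Finset.sum_powerset_insert (by simp),
          ← Finset.sum_add_distrib] at h0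
        rw [← h0]
        refine Finset.sum_congr rfl fun S hS => ?_
        rw [Finset.mem_powerset] at hS
        have hkS : k ∉ S := fun h => by simpa using hS h
        rw [Finset.insert_sdiff_of_notMem _ hkS, Finset.insert_sdiff_insert,
          Finset.sdiff_insert_of_notMem (by simp), Finset.image_insert, Finset.image_insert,
          Function.update_self, Function.update_self, himg _ _ _ Finset.sdiff_subset, himg _ _ _ hS,
          Finset.card_insert_of_notMem hkS, pow_succ, Finset.insert_union, Finset.union_insert]
        ring
      · intro z hz
        simp only [Finset.mem_erase]
        exact ⟨fun h => hyρ (h ▸ hz), fun h => hxρ (h ▸ hz), hρX hz⟩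
    obtain ⟨a, ha⟩ : A.Nonempty := Finset.card_pos.1 (by omega)
    have hk : (A.erase a).card = k := by rw [Finset.card_erase_of_mem ha]; omega
    have hsub : A.erase a ⊆ X := (Finset.erase_subset _ _).trans hA
    have h0 := hD (A.erase a) hsub (by omega)
    -- All summands equal `h A`, so `h A` times `#(X \ A.erase a)` is `0`, and that number is
    -- positive by the size of `X`.
    rw [Finset.sum_congr rfl (g := fun _ => h A), Finset.sum_const, nsmul_eq_mul,
      mul_eq_zero] at h0
    · refine h0.resolve_left ?_
      rw [Finset.card_sdiff_of_subset hsub, ← ne_eq, Nat.cast_ne_zero]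
      omega
    · intro c hc
      rw [Finset.mem_sdiff] at hc
      nth_rewrite 2 [← Finset.insert_erase ha]
      rcases eq_or_ne c a with rfl | hca
      · rfl
      · exact sub_eq_zero.1 (hpair c hc.1 a (hA ha) hca _ hsub hc.2 (by simp) hk)

/-! ### Spectral data read off from an eigenbasis -/

theorem charpoly_eq_prod_of_eigenbasis {V ι : Type*} [AddCommGroup V] [Module ℂ V]
    [Module.Finite ℂ V] [Fintype ι] [DecidableEq ι] (e : Module.Basis ι ℂ V) (T : V →ₗ[ℂ] V)
    (d : ι → ℂ) (hd : ∀ i, T (e i) = d i • e i) :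
    T.charpoly = ∏ i, (Polynomial.X - Polynomial.C (d i)) := by
  rw [← LinearMap.charpoly_toMatrix T e, ← Matrix.charpoly_diagonal]
  congr 1
  ext i j
  rw [LinearMap.toMatrix_apply, hd, map_smul, Module.Basis.repr_self, Finsupp.smul_apply,
    Matrix.diagonal_apply, Finsupp.single_apply]
  rcases eq_or_ne i j with rfl | hij
  · simp
  · simp [hij, hij.symm]

theorem finrank_eigenspace_of_eigenbasis {V ι : Type*} [AddCommGroup V] [Module ℂ V]
    [Module.Finite ℂ V] [Fintype ι] [DecidableEq ι] (e : Module.Basis ι ℂ V) (T : V →ₗ[ℂ] V)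
    (d : ι → ℂ) (hd : ∀ i, T (e i) = d i • e i) (μ : ℂ) [DecidablePred fun i => d i = μ] :
    Module.finrank ℂ (Module.End.eigenspace T μ) = (Finset.univ.filter fun i => d i = μ).card := by
  have h : Module.End.eigenspace T μ =
      Submodule.span ℂ (e '' {i | d i = μ}) := by
    apply le_antisymm
    · intro v hv
      rw [Module.End.mem_eigenspace_iff] at hv
      rw [Module.Basis.mem_span_image]
      intro i hi
      rw [Finset.mem_coe, Finsupp.mem_support_iff] at hi
      have hT : e.repr (T v) i = d i * e.repr v i := by
        have : (e.coord i).comp T = d i • e.coord i := by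
          refine e.ext fun j => ?_
          rw [LinearMap.comp_apply, hd, map_smul, LinearMap.smul_apply, Module.Basis.coord_apply,
            Module.Basis.repr_self, Finsupp.single_apply]
          rcases eq_or_ne j i with rfl | hij
          · rfl
          · simp [hij]
        exact LinearMap.congr_fun this v
      rw [hv, map_smul, Finsupp.smul_apply, smul_eq_mul] at hT
      exact (mul_right_cancel₀ hi hT).symm
    · rw [Submodule.span_le]
      rintro _ ⟨i, hi, rfl⟩
      rw [SetLike.mem_coe, Module.End.mem_eigenspace_iff, hd, show d i = μ from hi]
  have hli : LinearIndependent ℂ fun i : {i // d i = μ} => e i :=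
    e.linearIndependent.comp _ Subtype.val_injective
  have := finrank_span_eq_card hli
  rw [Fintype.card_subtype] at this
  rw [h, Set.image_eq_range]
  exact this

/-! ### The column group of the tableau -/

/-- The set of the last `k` elements of `Fin n`, the second row of the tableau `T_k`. -/
def lastFinset (n k : ℕ) : Finset (Fin n) := Finset.univ.filter fun i : Fin n => n - k ≤ (i : ℕ)

theorem mem_lastFinset {n k : ℕ} {i : Fin n} : i ∈ lastFinset n k ↔ n - k ≤ (i : ℕ) := by
  simp [lastFinset]

theorem coe_lastSubset (n m : ℕ) (hm : m ≤ n) :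
    (lastSubset n m hm : Finset (Fin n)) = lastFinset n m := rfl

theorem card_lastFinset {n k : ℕ} (h : k ≤ n) : (lastFinset n k).card = k :=
  Set.powersetCard.card_eq (lastSubset n k h)

theorem lastFinset_subset {n k m : ℕ} (h : k ≤ m) : lastFinset n k ⊆ lastFinset n m := by
  intro i
  rw [mem_lastFinset, mem_lastFinset]
  omega

/-- The entry in the same column of `T_k` (the entry itself in a column of length one). -/
def colPartner (n k : ℕ) (i : Fin n) : Fin n :=
  if h : (i : ℕ) < k then ⟨i + (n - k), by omega⟩
  else if n - k ≤ (i : ℕ) then ⟨i - (n - k), by omega⟩ else i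

theorem colPartner_val (n k : ℕ) (i : Fin n) : (colPartner n k i : ℕ) =
    if (i : ℕ) < k then (i : ℕ) + (n - k) else if n - k ≤ (i : ℕ) then i - (n - k) else i := by
  unfold colPartner
  split_ifs <;> rfl

theorem colIdx_colPartner {n k : ℕ} (h : 2 * k ≤ n) (i : Fin n) :
    colIdx n k (colPartner n k i) = colIdx n k i := by
  unfold colIdx
  rw [colPartner_val]
  split_ifs <;> omega

theorem colPartner_colPartner {n k : ℕ} (h : 2 * k ≤ n) (i : Fin n) :
    colPartner n k (colPartner n k i) = i := by
  ext
  rw [colPartner_val, colPartner_val]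
  split_ifs <;> omega

/-- The element of `C(T_k)` that exchanges the two entries in the columns belonging to `S`. -/
def colPerm {n k : ℕ} (h : 2 * k ≤ n) (S : Finset ℕ) : Perm (Fin n) :=
  Function.Involutive.toPerm
    (fun i => if colIdx n k i ∈ S then colPartner n k i else i) (by
      intro i
      by_cases hi : colIdx n k i ∈ S
      · simp [hi, colIdx_colPartner h, colPartner_colPartner h]
      · simp [hi])

theorem colPerm_apply {n k : ℕ} (h : 2 * k ≤ n) (S : Finset ℕ) (i : Fin n) :
    colPerm h S i = if colIdx n k i ∈ S then colPartner n k i else i := rfl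

theorem colPerm_inv {n k : ℕ} (h : 2 * k ≤ n) (S : Finset ℕ) : (colPerm h S)⁻¹ = colPerm h S :=
  Function.Involutive.toPerm_symm _

theorem colPerm_mem {n k : ℕ} (h : 2 * k ≤ n) (S : Finset ℕ) :
    colPerm h S ∈ colSubgroup n k := by
  intro i
  rw [colPerm_apply]
  split_ifs
  · exact colIdx_colPartner h i
  · rfl

/-- Each column in `S` contributes one transposition. Indices from `k` on must be excluded: they
contribute no transposition. -/
theorem sign_colPerm {n k : ℕ} (h : 2 * k ≤ n) (S : Finset ℕ) (hS : S ⊆ Finset.range k) :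
    Perm.sign (colPerm h S) = (-1) ^ S.card := by
  induction S using Finset.induction_on with
  | empty =>
    have : colPerm h ∅ = 1 := by ext i; simp [colPerm_apply]
    simp [this]
  | insert c S hc ih =>
    have hck : c < k := Finset.mem_range.1 (hS (by simp))
    have hne : (⟨c, by omega⟩ : Fin n) ≠ ⟨n - k + c, by omega⟩ := by
      rw [ne_eq, Fin.mk.injEq]; omega
    have : colPerm h (insert c S) =
        swap (⟨c, by omega⟩ : Fin n) ⟨n - k + c, by omega⟩ * colPerm h S := by
      ext i
      rw [Perm.mul_apply, colPerm_apply, colPerm_apply, swap_apply_def]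
      by_cases hi : colIdx n k i = c
      · rw [hi, if_pos (by simp), if_neg hc]
        simp only [Fin.ext_iff]
        rw [apply_ite Fin.val, apply_ite Fin.val, colPartner_val]
        unfold colIdx at hi
        split_ifs at hi ⊢ <;> (try dsimp only) <;> omega
      · have h2 : ∀ j : Fin n, colIdx n k j = colIdx n k i →
            j ≠ (⟨c, by omega⟩ : Fin n) ∧ j ≠ ⟨n - k + c, by omega⟩ := by
          intro j hj
          rw [← hj] at hi
          constructor
          · rintro rfl
            exact hi (by unfold colIdx; rw [if_pos (by simp only []; omega)])
          · rintro rfl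
            exact hi (by unfold colIdx; rw [if_neg (by simp only []; omega)]; simp)
        simp only [Finset.mem_insert, hi, false_or]
        have h3 : colIdx n k (if colIdx n k i ∈ S then colPartner n k i else i) = colIdx n k i :=
          colPerm_mem h S i
        rw [if_neg (h2 _ h3).1, if_neg (h2 _ h3).2]
    rw [this, Perm.sign_mul, Perm.sign_swap hne,
      ih ((Finset.subset_insert _ _).trans hS), Finset.card_insert_of_notMem hc, pow_succ, mul_comm]

open Classical in
-- The first `k` columns have two entries and the others one, so an element of the column group is
-- determined by the set of columns it swaps, namely those whose first-row entry it moves.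
theorem sum_colSubgroup {n k : ℕ} (h : 2 * k ≤ n) (F : Perm (Fin n) → ℂ) :
    ∑ q : Perm (Fin n) with q ∈ colSubgroup n k, (((Perm.sign q : ℤˣ) : ℤ) : ℂ) * F q =
      ∑ S ∈ (Finset.range k).powerset, (-1) ^ S.card * F (colPerm h S) := by
  symm
  refine Finset.sum_bij' (fun S _ => colPerm h S)
    (fun q _ => (Finset.range k).filter fun c => ∃ i : Fin n, (i : ℕ) = c ∧ q i ≠ i) ?_ ?_ ?_ ?_ ?_
  · intro S _
    simpa using colPerm_mem h S
  · intro q _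
    simp
  · intro S hS
    ext c
    rw [Finset.mem_filter, Finset.mem_range]
    constructor
    · rintro ⟨hc, i, rfl, hi⟩
      rw [colPerm_apply] at hi
      by_contra hS'
      exact hi (if_neg (by unfold colIdx; rwa [if_pos (by omega)]))
    · intro hc
      have hck : c < k := by simpa using (Finset.mem_powerset.1 hS) hc
      refine ⟨hck, ⟨c, by omega⟩, rfl, ?_⟩
      rw [colPerm_apply, if_pos (by unfold colIdx; rwa [if_pos (by simp only []; omega)]), ne_eq,
        Fin.ext_iff, colPartner_val, if_pos hck]
      simp only []
      omega
  · intro q hq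
    have hqc : ∀ i, colIdx n k (q i) = colIdx n k i := (Finset.mem_filter.1 hq).2
    have hcase : ∀ i j : Fin n, colIdx n k j = colIdx n k i → j = i ∨ j = colPartner n k i := by
      intro i j hij
      rw [Fin.ext_iff, Fin.ext_iff, colPartner_val]
      unfold colIdx at hij
      split_ifs at hij ⊢ <;> omega
    ext i
    rw [colPerm_apply]
    congr 1
    by_cases hk : colIdx n k i < k
    · have hcn : colIdx n k i < n := by omega
      have hd : (⟨colIdx n k i, hcn⟩ : Fin n) = i ∨ (⟨colIdx n k i, hcn⟩ : Fin n) =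
          colPartner n k i := by
        apply hcase
        change (if colIdx n k i < n - k then colIdx n k i else _) = _
        exact if_pos (by omega)
      -- In a column of length two, the first-row entry is moved exactly when either entry is.
      have hfix : q ⟨colIdx n k i, hcn⟩ ≠ ⟨colIdx n k i, hcn⟩ ↔ q i ≠ i := by
        rcases hd with hd | hd
        · rw [hd]
        · rw [hd, not_iff_not]
          constructor
          · intro h1
            rcases hcase i (q i) (hqc i) with h2 | h2
            · exact h2
            · rw [← h1] at h2
              exact h2 ▸ h1.symm ▸ q.injective h2 ▸ rfl
          · intro h1
            rcases hcase i (q (colPartner n k i)) (by rw [hqc, colIdx_colPartner h]) with h2 | h2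
            · have := q.injective (h2.trans h1.symm)
              rw [this, h1]
            · exact h2
      simp only [Finset.mem_filter, Finset.mem_range, hk, true_and]
      by_cases hqi : q i = i
      · rw [if_neg, hqi]
        rintro ⟨j, hj, hne⟩
        obtain rfl : j = ⟨colIdx n k i, hcn⟩ := Fin.ext hj
        exact hfix.1 hne hqi
      · rw [if_pos ⟨_, rfl, hfix.2 hqi⟩]
        exact ((hcase i (q i) (hqc i)).resolve_left hqi).symm
    · rw [if_neg (by simp [hk])]
      rcases hcase i (q i) (hqc i) with h2 | h2
      · exact h2.symm
      · rw [h2, Fin.ext_iff, colPartner_val]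
        unfold colIdx at hk
        split_ifs at hk ⊢ <;> omega
  · intro S hS
    rw [sign_colPerm h S (Finset.mem_powerset.1 hS)]
    push_cast
    rfl

/-- Column `i` contributes its lower entry if it is not swapped and its upper entry if it is. The
image form matches the alternating sums of `eq_zero_of_sum_insert_eq_zero_of_differences`. -/
theorem colPerm_smul_lastFinset {n k : ℕ} [NeZero n] (h : 2 * k ≤ n) (S : Finset ℕ)
    (hS : S ⊆ Finset.range k) :
    colPerm h S • lastFinset n k =
      (Finset.range k \ S).image (fun i => Fin.ofNat n (n - k + i)) ∪ S.image (Fin.ofNat n) := by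
  ext x
  rw [← Finset.inv_smul_mem_iff, colPerm_inv, Perm.smul_def, mem_lastFinset, colPerm_apply]
  simp only [Finset.mem_union, Finset.mem_image, Finset.mem_sdiff, Finset.mem_range, Fin.ext_iff,
    Fin.ofNat]
  rw [apply_ite Fin.val, colPartner_val]
  constructor
  · intro hx
    by_cases hxS : colIdx n k x ∈ S
    · right
      have := Finset.mem_range.1 (hS hxS)
      refine ⟨_, hxS, ?_⟩
      rw [if_pos hxS] at hx
      rw [Nat.mod_eq_of_lt (by omega)]
      unfold colIdx at this ⊢
      split_ifs at * <;> omega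
    · left
      rw [if_neg hxS] at hx
      refine ⟨x - (n - k), ⟨by omega, ?_⟩, ?_⟩
      · unfold colIdx at hxS
        rwa [if_neg (by omega)] at hxS
      · rw [Nat.mod_eq_of_lt (by omega)]; omega
  · rintro (⟨c, ⟨hc, hcS⟩, hcx⟩ | ⟨c, hcS, hcx⟩)
    · rw [Nat.mod_eq_of_lt (by omega)] at hcx
      rw [if_neg]
      · omega
      · unfold colIdx
        rw [if_neg (by omega), ← hcx]
        simpa using hcS
    · have := Finset.mem_range.1 (hS hcS)
      rw [Nat.mod_eq_of_lt (by omega)] at hcx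
      rw [if_pos]
      · rw [if_pos (by omega)]; omega
      · unfold colIdx
        rw [if_pos (by omega), ← hcx]
        exact hcS

/-! ### Polytabloids and finite differences -/

/-- The `k`-th finite difference of `h` at `0`. -/
def binomDiff (k : ℕ) (h : ℕ → ℂ) : ℂ :=
  ∑ j ∈ Finset.range (k + 1), (-1) ^ (k - j) * (k.choose j : ℂ) * h j

theorem binomDiff_single (k : ℕ) : binomDiff k (fun j => if j = k then 1 else 0) = 1 := by
  simp [binomDiff]

theorem sum_powerset_eq_binomDiff (k : ℕ) (h : ℕ → ℂ) :
    ∑ S ∈ (Finset.range k).powerset, (-1) ^ S.card * h (Finset.range k \ S).card =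
      binomDiff k h := by
  have : ∀ S ∈ (Finset.range k).powerset, (-1 : ℂ) ^ S.card * h (Finset.range k \ S).card =
      (fun j => (-1 : ℂ) ^ j * h (k - j)) S.card := by
    intro S hS
    rw [Finset.card_sdiff_of_subset (Finset.mem_powerset.1 hS), Finset.card_range]
  rw [Finset.sum_congr rfl this, Finset.sum_powerset_apply_card (fun j => (-1 : ℂ) ^ j * h (k - j)),
    Finset.card_range, binomDiff,
    ← Finset.sum_range_reflect]
  refine Finset.sum_congr rfl fun j hj => ?_
  have hj : j ≤ k := by simpa [Nat.lt_succ_iff] using hj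
  simp only [Nat.add_sub_cancel, nsmul_eq_mul]
  rw [Nat.choose_symm hj, Nat.sub_sub_self hj]
  ring

/-- The coefficient at `τ` of the polytabloid of `T_k` multiplied by all sets of complementary
entries: a signed count of column permutations moving `τ` onto a set containing the second row. -/
def polytabloid {n k : ℕ} (h : 2 * k ≤ n) (τ : Finset (Fin n)) : ℂ :=
  ∑ S ∈ (Finset.range k).powerset,
    (-1) ^ S.card * if lastFinset n k ⊆ colPerm h S • τ then 1 else 0

theorem subset_iff_card_inter {n k : ℕ} (hk : k ≤ n) (τ : Finset (Fin n)) :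
    lastFinset n k ⊆ τ ↔ (τ ∩ lastFinset n k).card = k := by
  constructor
  · intro h
    rw [Finset.inter_eq_right.2 h, card_lastFinset hk]
  · intro h
    rw [← Finset.inter_eq_right]
    exact Finset.eq_of_subset_of_card_le Finset.inter_subset_right
      (by rw [h, card_lastFinset hk])

/-- The intersection number is a sum over columns of membership of the lower or the upper entry in
`τ`, so `exists_sum_powerset_neg_one_pow` gives a factor `ε` independent of `g`. -/
theorem sum_powerset_card_inter {n k : ℕ} [NeZero n] (h : 2 * k ≤ n) (τ : Finset (Fin n))
    (g : ℕ → ℂ) :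
    ∑ S ∈ (Finset.range k).powerset,
      (-1) ^ S.card * g ((colPerm h S • τ) ∩ lastFinset n k).card =
      polytabloid h τ * binomDiff k g := by
  obtain ⟨ε, hε⟩ := exists_sum_powerset_neg_one_pow (Finset.range k)
    (fun i => if Fin.ofNat n (n - k + i) ∈ τ then 1 else 0)
    (fun i => if Fin.ofNat n i ∈ τ then 1 else 0)
    (fun i _ => by split_ifs <;> simp) (fun i _ => by split_ifs <;> simp)
  have hcard : ∀ S ∈ (Finset.range k).powerset, ((colPerm h S • τ) ∩ lastFinset n k).card =
      ∑ i ∈ Finset.range k \ S, (if Fin.ofNat n (n - k + i) ∈ τ then 1 else 0) +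
        ∑ i ∈ S, (if Fin.ofNat n i ∈ τ then 1 else 0) := by
    intro S hS
    rw [Finset.mem_powerset] at hS
    -- Because the column permutation is an involution, it can be transferred to the second row,
    -- whose image is known explicitly.
    have h1 : (colPerm h S • τ) ∩ lastFinset n k =
        colPerm h S • (τ ∩ colPerm h S • lastFinset n k) := by
      rw [Finset.smul_finset_inter, smul_smul]
      nth_rewrite 3 [← colPerm_inv]
      rw [inv_mul_cancel, one_smul]
    have hi : ∀ i < n, ∀ j < n, Fin.ofNat n i = Fin.ofNat n j → i = j := by
      intro i hi j hj hij
      rw [Fin.ext_iff] at hij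
      simpa [Fin.ofNat, Nat.mod_eq_of_lt hi, Nat.mod_eq_of_lt hj] using hij
    have hSk : ∀ i ∈ S, i < k := fun i hi => Finset.mem_range.1 (hS hi)
    rw [h1, Finset.card_smul_finset, colPerm_smul_lastFinset h S hS, Finset.inter_union_distrib_left,
      Finset.card_union_of_disjoint]
    · congr 1
      · rw [Finset.inter_comm, ← Finset.filter_mem_eq_inter, Finset.filter_image,
          Finset.card_image_of_injOn, Finset.card_filter]
        intro i hi' j hj' hij
        simp only [Finset.coe_filter, Finset.mem_sdiff, Finset.mem_range, Set.mem_ofPred_eq] at hi' hj'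
        have := hi (n - k + i) (by omega) (n - k + j) (by omega) hij
        omega
      · rw [Finset.inter_comm, ← Finset.filter_mem_eq_inter, Finset.filter_image,
          Finset.card_image_of_injOn, Finset.card_filter]
        intro i hi' j hj' hij
        simp only [Finset.coe_filter, Set.mem_ofPred_eq] at hi' hj'
        have h1 := hSk i hi'.1
        have h2 := hSk j hj'.1
        exact hi i (by omega) j (by omega) hij
    · refine Finset.disjoint_of_subset_left Finset.inter_subset_right
        (Finset.disjoint_of_subset_right Finset.inter_subset_right ?_)
      rw [Finset.disjoint_left]
      simp only [Finset.mem_image, Finset.mem_sdiff, Finset.mem_range]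
      rintro _ ⟨i, ⟨hik, hiS⟩, rfl⟩ ⟨j, hj, hij⟩
      have h2 := hSk j hj
      have := hi j (by omega) (n - k + i) (by omega) hij
      omega
  have key : ∀ g : ℕ → ℂ, ∑ S ∈ (Finset.range k).powerset,
      (-1) ^ S.card * g ((colPerm h S • τ) ∩ lastFinset n k).card = ε * binomDiff k g := by
    intro g
    rw [← sum_powerset_eq_binomDiff, ← hε]
    exact Finset.sum_congr rfl fun S hS => by rw [hcard S hS]
  -- Testing on the indicator of `k`, whose `k`-th difference is `1`, identifies `ε`: intersection
  -- number `k` means that the second row is contained.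
  have hpoly : polytabloid h τ = ε := by
    have := key (fun j => if j = k then 1 else 0)
    rw [binomDiff_single, mul_one] at this
    rw [← this]
    unfold polytabloid
    simp only [subset_iff_card_inter (show k ≤ n by omega)]
  rw [key, hpoly]

/-! ### The projection of the Young symmetrizer -/

theorem sum_setPowersetCard_of_subset {α : Type*} [Fintype α] [DecidableEq α] {m : ℕ}
    [Fintype (Set.powersetCard α m)] (ρ : Finset α) (hρ : ρ.card ≤ m) (f : Finset α → ℂ) :
    ∑ σ : Set.powersetCard α m, (if ρ ⊆ (σ : Finset α) then f σ else 0) =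
      ∑ Y ∈ ρᶜ.powersetCard (m - ρ.card), f (ρ ∪ Y) := by
  rw [← Finset.sum_filter]
  refine Finset.sum_bij' (fun σ _ => (σ : Finset α) \ ρ)
    (fun Y hY => ⟨ρ ∪ Y, by
      rw [Finset.mem_powersetCard] at hY
      rw [Set.powersetCard.mem_iff, Finset.card_union_of_disjoint
        (Finset.disjoint_of_subset_right hY.1 disjoint_compl_right)]
      omega⟩) ?_ ?_ ?_ ?_ ?_
  · intro σ hσ
    have hσ := (Finset.mem_filter.1 hσ).2
    rw [Finset.mem_powersetCard, Finset.card_sdiff_of_subset hσ, Set.powersetCard.card_eq]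
    exact ⟨fun x hx => by simpa using (Finset.mem_sdiff.1 hx).2, rfl⟩
  · intro Y hY
    simp
  · intro σ hσ
    have hσ := (Finset.mem_filter.1 hσ).2
    exact Subtype.ext (Finset.union_sdiff_of_subset hσ)
  · intro Y hY
    rw [Finset.mem_powersetCard] at hY
    exact Finset.union_sdiff_cancel_left (Finset.disjoint_of_subset_right hY.1 disjoint_compl_right)
  · intro σ hσ
    have hσ := (Finset.mem_filter.1 hσ).2
    rw [Finset.union_sdiff_of_subset hσ]

theorem proj_apply (n m : ℕ) (hm : m ≤ n) (y : GroupAlg n) (τ : Set.powersetCard (Fin n) m) :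
    proj n m hm y τ = ∑ p : Perm (Fin n),
      y.coeff p * if p • lastFinset n m = (τ : Finset (Fin n)) then 1 else 0 := by
  unfold proj
  rw [LinearMap.comp_apply, Finsupp.linearCombination_apply, Finsupp.sum_fintype _ _ (by simp),
    Finset.sum_apply]
  refine Finset.sum_congr rfl fun p _ => ?_
  rw [Pi.smul_apply, smul_eq_mul, Pi.single_apply]
  congr 1
  refine if_congr ?_ rfl rfl
  rw [← Subtype.coe_inj, Set.powersetCard.coe_smul, coe_lastSubset, eq_comm]

theorem proj_single (n m : ℕ) (hm : m ≤ n) (g : Perm (Fin n)) (c : ℂ)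
    (τ : Set.powersetCard (Fin n) m) :
    proj n m hm (MonoidAlgebra.single g c) τ =
      c * if g • lastFinset n m = (τ : Finset (Fin n)) then 1 else 0 := by
  classical
  rw [proj_apply, Finset.sum_eq_single g]
  · simp
  · intro p _ hp
    simp [hp.symm]
  · simp

theorem proj_single_mul (n m : ℕ) (hm : m ≤ n) (g : Perm (Fin n)) (y : GroupAlg n)
    (τ : Set.powersetCard (Fin n) m) :
    proj n m hm (MonoidAlgebra.single g 1 * y) τ = proj n m hm y (g⁻¹ • τ) := by
  rw [proj_apply, proj_apply, ← Equiv.sum_comp (Equiv.mulLeft g)]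
  refine Finset.sum_congr rfl fun p _ => ?_
  rw [Equiv.coe_mulLeft, MonoidAlgebra.coeff_single_mul_apply, one_mul, inv_mul_cancel_left,
    Set.powersetCard.coe_smul, mul_smul]
  simp only [eq_inv_smul_iff]

theorem rowSubgroup_smul_lastFinset {n k : ℕ} {p : Perm (Fin n)} :
    p ∈ rowSubgroup n k ↔ p • lastFinset n k = lastFinset n k := by
  have hr : ∀ i, i ∈ lastFinset n k ↔ rowIdx n k i = 1 := by
    intro i
    rw [mem_lastFinset]
    unfold rowIdx
    split_ifs <;> simp <;> omega
  have hr0 : ∀ i, i ∉ lastFinset n k ↔ rowIdx n k i = 0 := by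
    intro i
    rw [mem_lastFinset]
    unfold rowIdx
    split_ifs <;> simp <;> omega
  constructor
  · intro hp
    refine Finset.eq_of_subset_of_card_le ?_ (by simp)
    intro i hi
    obtain ⟨j, hj, rfl⟩ := Finset.mem_smul_finset.1 hi
    rw [hr] at hj ⊢
    exact (hp j).trans hj
  · intro hp i
    by_cases hi : i ∈ lastFinset n k
    · have h2 : p i ∈ lastFinset n k := by
        rw [← hp]; exact Finset.smul_mem_smul_finset hi
      rw [hr] at hi h2
      rw [hi, h2]
    · have h2 : p i ∉ lastFinset n k := by
        rw [← hp, ← Perm.smul_def, Finset.smul_mem_smul_finset_iff]; exact hi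
      rw [hr0] at hi h2
      rw [hi, h2]

open Classical in
-- The orbit of `Ω` under the row group consists of the `m`-sets containing the second row, and each
-- is reached equally often. `N` is the order of the stabilizer of `Ω` in the row group.
theorem exists_sum_rowSubgroup {n k m : ℕ} (hk : k ≤ m) (hm : m ≤ n) :
    ∃ N : ℕ, N ≠ 0 ∧ ∀ τ : Finset (Fin n), τ.card = m →
      (∑ p : Perm (Fin n) with p ∈ rowSubgroup n k,
        if p • lastFinset n m = τ then (1 : ℂ) else 0) =
        N * if lastFinset n k ⊆ τ then 1 else 0 := by
  refine ⟨((Finset.univ.filter fun p : Perm (Fin n) => p ∈ rowSubgroup n k).filter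
    fun p => p • lastFinset n m = lastFinset n m).card, ?_, ?_⟩
  · rw [← Nat.pos_iff_ne_zero, Finset.card_pos]
    exact ⟨1, by simp [one_mem]⟩
  · intro τ hτ
    split_ifs with h
    · obtain ⟨g, hg, hgτ⟩ := exists_perm_smul_eq (lastFinset n k) (σ := lastFinset n m) (τ := τ)
        (by rw [card_lastFinset hm, hτ])
        (by rw [Finset.inter_eq_right.2 h, Finset.inter_eq_right.2 (lastFinset_subset hk)])
      have hgR : g ∈ rowSubgroup n k := by
        rw [rowSubgroup_smul_lastFinset]
        ext x
        rw [Finset.mem_smul_finset]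
        constructor
        · rintro ⟨y, hy, rfl⟩
          rwa [Perm.smul_def, hg y hy]
        · intro hx
          exact ⟨x, hx, hg x hx⟩
      rw [mul_one, ← Finset.sum_boole, Finset.sum_filter, Finset.sum_filter,
        ← Equiv.sum_comp (Equiv.mulLeft g)]
      refine Finset.sum_congr rfl fun p _ => ?_
      rw [Equiv.coe_mulLeft, Subgroup.mul_mem_cancel_left _ hgR, ← hgτ, mul_smul]
      simp only [smul_left_cancel_iff]
    · rw [mul_zero]
      refine Finset.sum_eq_zero fun p hp => if_neg ?_
      rintro rfl
      rw [Finset.mem_filter, rowSubgroup_smul_lastFinset] at hp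
      refine h ?_
      conv_lhs => rw [← hp.2]
      exact Finset.smul_finset_subset_smul_finset (lastFinset_subset hk)

theorem exists_proj_youngSymm {n k m : ℕ} (hk : k ≤ m) (hm : m ≤ n) (h : 2 * k ≤ n) :
    ∃ N : ℕ, N ≠ 0 ∧ ∀ τ : Set.powersetCard (Fin n) m,
      proj n m hm (youngSymm n k) τ = N * polytabloid h (τ : Finset (Fin n)) := by
  classical
  obtain ⟨N, hN, hsum⟩ := exists_sum_rowSubgroup hk hm
  refine ⟨N, hN, fun τ => ?_⟩
  rw [youngSymm, colSum, rowSum, Finset.sum_mul_sum, map_sum, Finset.sum_apply]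
  have : ∀ q : Perm (Fin n), proj n m hm (∑ p : Perm (Fin n) with p ∈ rowSubgroup n k,
      MonoidAlgebra.single q (((Perm.sign q : ℤˣ) : ℤ) : ℂ) * MonoidAlgebra.single p 1) τ =
      (((Perm.sign q : ℤˣ) : ℤ) : ℂ) * (N * if lastFinset n k ⊆ q⁻¹ • (τ : Finset (Fin n))
        then 1 else 0) := by
    intro q
    rw [map_sum, Finset.sum_apply, ← hsum _ (by simp), Finset.mul_sum]
    refine Finset.sum_congr rfl fun p _ => ?_
    rw [MonoidAlgebra.single_mul_single, proj_single, mul_one, mul_smul]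
    simp only [eq_inv_smul_iff]
  simp only [map_sum, Finset.sum_apply] at this ⊢
  simp only [this]
  rw [sum_colSubgroup h, polytabloid, Finset.mul_sum]
  refine Finset.sum_congr rfl fun S _ => ?_
  rw [colPerm_inv]
  ring

/-- Only `S = ∅` contributes: swapping a column `c < k` would require `c ∈ Ω`, but `c < n - m`. This
is what makes `π(c_k)` nonzero. -/
theorem polytabloid_lastFinset {n k m : ℕ} (hk : k ≤ m) (hm : m + k ≤ n) (h : 2 * k ≤ n) :
    polytabloid h (lastFinset n m) = 1 := by
  rw [polytabloid, Finset.sum_eq_single ∅]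
  · have : colPerm h ∅ = 1 := by ext i; simp [colPerm_apply]
    rw [this, one_smul, if_pos (lastFinset_subset hk)]
    simp
  · intro S hS hne
    obtain ⟨c, hc⟩ := Finset.nonempty_iff_ne_empty.2 hne
    have hck : c < k := Finset.mem_range.1 ((Finset.mem_powerset.1 hS) hc)
    rw [if_neg, mul_zero]
    intro hsub
    have h1 : (⟨n - k + c, by omega⟩ : Fin n) ∈ lastFinset n k := by
      rw [mem_lastFinset]; simp
    have h2 := hsub h1
    rw [← Finset.inv_smul_mem_iff, colPerm_inv, Perm.smul_def, colPerm_apply, if_pos,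
      mem_lastFinset, colPartner_val] at h2
    · simp only [] at h2
      split_ifs at h2 <;> omega
    · unfold colIdx
      rw [if_neg (by simp)]
      simpa using hc
  · simp

/-! ### The eigenvector equation -/

theorem sum_smul_setPowersetCard {n m : ℕ} (q : Perm (Fin n)) (f : Finset (Fin n) → ℂ) :
    ∑ σ : Set.powersetCard (Fin n) m, f (q • (σ : Finset (Fin n))) =
      ∑ σ : Set.powersetCard (Fin n) m, f σ := by
  exact Equiv.sum_comp (MulAction.toPerm q : Perm (Set.powersetCard (Fin n) m)) fun σ => f σ

/-- Write `σ = L ∪ Y` with `L` the second row and `Y` disjoint from it, and sort by `p = #(Y ∩ (τ \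
L))`. With `j = #(τ ∩ L)`, the set `τ \ L` has `m - j` elements and the rest of the complement of
`L` has `n - m - k + j`. -/
theorem sum_card_inter_of_lastFinset_subset {n k m : ℕ} (hk : k ≤ m) (hm : m + k ≤ n)
    (b : ℕ → ℂ) (τ : Finset (Fin n)) (hτ : τ.card = m) :
    ∑ σ : Set.powersetCard (Fin n) m, (if lastFinset n k ⊆ (σ : Finset (Fin n))
      then b (τ ∩ (σ : Finset (Fin n))).card else 0) =
    (fun j => ∑ p ∈ Finset.range (m - k + 1), ((m - j).choose p : ℂ) *
      ((n - m - k + j).choose (m - k - p) : ℂ) * b (j + p)) (τ ∩ lastFinset n k).card := by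
  have hc : (lastFinset n k).card = k := card_lastFinset (by omega)
  rw [sum_setPowersetCard_of_subset _ (by omega) fun σ => b (τ ∩ σ).card, hc]
  have hT : τ \ lastFinset n k ⊆ (lastFinset n k)ᶜ := fun x hx => by
    simpa using (Finset.mem_sdiff.1 hx).2
  have h1 : (τ \ lastFinset n k).card = m - (τ ∩ lastFinset n k).card := by
    have := Finset.card_inter_add_card_sdiff τ (lastFinset n k); omega
  have hle : (τ ∩ lastFinset n k).card ≤ m := by
    have := Finset.card_inter_add_card_sdiff τ (lastFinset n k); omega
  have h2 : ((lastFinset n k)ᶜ \ (τ \ lastFinset n k)).card =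
      n - m - k + (τ ∩ lastFinset n k).card := by
    rw [Finset.card_sdiff_of_subset hT, h1, Finset.card_compl, Fintype.card_fin, hc]
    omega
  have h3 := sum_powersetCard_card_inter hT (m - k) fun p => b ((τ ∩ lastFinset n k).card + p)
  rw [h1, h2] at h3
  dsimp only
  rw [← h3]
  refine Finset.sum_congr rfl fun Y hY => ?_
  have hY := (Finset.mem_powersetCard.1 hY).1
  have hdis : Disjoint (lastFinset n k) Y :=
    Finset.disjoint_of_subset_right hY disjoint_compl_right
  rw [Finset.inter_union_distrib_left, Finset.card_union_of_disjoint]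
  · suffices hYT : τ ∩ Y = Y ∩ (τ \ lastFinset n k) by rw [hYT]
    ext x
    have hx : x ∈ lastFinset n k → x ∉ Y := fun hx => Finset.disjoint_left.1 hdis hx
    simp only [Finset.mem_inter, Finset.mem_sdiff]
    tauto
  · exact Finset.disjoint_of_subset_left Finset.inter_subset_right
      (Finset.disjoint_of_subset_right Finset.inter_subset_right hdis)

theorem eigval_eq_binomDiff (n m k : ℕ) (b : ℕ → ℂ) :
    eigval n m k b = binomDiff k fun j => ∑ p ∈ Finset.range (m - k + 1),
      ((m - j).choose p : ℂ) * ((n - m - k + j).choose (m - k - p) : ℂ) * b (j + p) := by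
  unfold eigval binomDiff
  refine Finset.sum_congr rfl fun j _ => ?_
  rw [Finset.mul_sum]
  exact Finset.sum_congr rfl fun p _ => by ring

/-- Averaging a polytabloid against a function of intersections is a finite difference. -/
theorem sum_mul_polytabloid {n k m : ℕ} [NeZero n] (h : 2 * k ≤ n) (K : Finset (Fin n) → Finset (Fin n) → ℂ)
    (hK : ∀ (q : Perm (Fin n)) ρ σ, K (q • ρ) (q • σ) = K ρ σ) (g : ℕ → ℂ)
    (τ : Finset (Fin n))
    (hg : ∀ q : Perm (Fin n), ∑ σ : Set.powersetCard (Fin n) m,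
      (if lastFinset n k ⊆ (σ : Finset (Fin n)) then K (q • τ) σ else 0) =
        g ((q • τ) ∩ lastFinset n k).card) :
    ∑ σ : Set.powersetCard (Fin n) m, K τ σ * polytabloid h (σ : Finset (Fin n)) =
      polytabloid h τ * binomDiff k g := by
  rw [← sum_powerset_card_inter]
  simp only [polytabloid, Finset.mul_sum]
  rw [Finset.sum_comm]
  refine Finset.sum_congr rfl fun S _ => ?_
  -- Reindexing `σ` by the column permutation and using the invariance of `K` moves that permutation
  -- onto `τ`.
  rw [← hg, Finset.mul_sum, ← sum_smul_setPowersetCard (colPerm h S) fun σ =>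
    (-1) ^ S.card * if lastFinset n k ⊆ σ then K (colPerm h S • τ) σ else 0]
  refine Finset.sum_congr rfl fun σ _ => ?_
  rw [hK]
  split_ifs <;> ring

theorem intertwiner_mulVec_proj_youngSymm {n k m : ℕ} [NeZero n] (hk : k ≤ m) (hm : m ≤ n)
    (hmk : m + k ≤ n) (b : ℕ → ℂ) :
    (intertwiner n m b).mulVec (proj n m hm (youngSymm n k)) =
      eigval n m k b • proj n m hm (youngSymm n k) := by
  have h : 2 * k ≤ n := by omega
  obtain ⟨N, -, hN⟩ := exists_proj_youngSymm hk hm h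
  ext τ
  rw [Matrix.mulVec, dotProduct, Pi.smul_apply, hN, smul_eq_mul, eigval_eq_binomDiff]
  have := sum_mul_polytabloid (m := m) h (fun ρ σ => b (ρ ∩ σ).card)
    (fun q ρ σ => by rw [← Finset.smul_finset_inter, Finset.card_smul_finset])
    (fun j => ∑ p ∈ Finset.range (m - k + 1), ((m - j).choose p : ℂ) *
      ((n - m - k + j).choose (m - k - p) : ℂ) * b (j + p)) (τ : Finset (Fin n))
    (fun q => sum_card_inter_of_lastFinset_subset hk hmk b (q • (τ : Finset (Fin n)))
      (by rw [Finset.card_smul_finset, Set.powersetCard.card_eq]))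
  rw [mul_comm, mul_assoc, ← this, Finset.mul_sum]
  refine Finset.sum_congr rfl fun σ _ => ?_
  rw [hN, intertwiner, Matrix.of_apply]
  ring

theorem proj_youngSymm_ne_zero {n k m : ℕ} (hk : k ≤ m) (hm : m ≤ n) (hmk : m + k ≤ n) :
    proj n m hm (youngSymm n k) ≠ 0 := by
  have h : 2 * k ≤ n := by omega
  obtain ⟨N, hN0, hN⟩ := exists_proj_youngSymm hk hm h
  intro h0
  have := hN (lastSubset n m hm)
  rw [h0, coe_lastSubset, polytabloid_lastFinset hk hmk] at this
  simp at this
  exact hN0 (by exact_mod_cast this.symm)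

/-! ### Injectivity of the projection on the Specht module -/

theorem rowSum_mul_single {n k : ℕ} {p : Perm (Fin n)} (hp : p ∈ rowSubgroup n k) :
    rowSum n k * MonoidAlgebra.single p 1 = rowSum n k := by
  classical
  rw [rowSum, Finset.sum_mul]
  simp only [MonoidAlgebra.single_mul_single, one_mul]
  rw [Finset.sum_filter, Finset.sum_filter, ← Equiv.sum_comp (Equiv.mulRight p)
    fun g => if g ∈ rowSubgroup n k then (MonoidAlgebra.single g 1 : GroupAlg n) else 0]
  refine Finset.sum_congr rfl fun g _ => ?_
  rw [Equiv.coe_mulRight]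
  simp only [Subgroup.mul_mem_cancel_right _ hp]

theorem coeff_mul_of_mem_specht {n k : ℕ} {y : GroupAlg n} (hy : y ∈ specht n k)
    {p : Perm (Fin n)} (hp : p ∈ rowSubgroup n k) (g : Perm (Fin n)) :
    y.coeff (g * p) = y.coeff g := by
  obtain ⟨x, rfl⟩ := hy
  rw [LinearMap.mulRight_apply, youngSymm, ← mul_assoc]
  conv_lhs => rw [← rowSum_mul_single hp, ← mul_assoc]
  rw [MonoidAlgebra.coeff_mul_single_apply, mul_one, mul_inv_cancel_right]

/-- For `m = k` the row group is the stabilizer of `Ω`. Elements of the Specht module are constant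
on its left cosets, so the value of `π y` at `gΩ` is the order of the row group times the
coefficient of `y` at `g`. -/
theorem eq_zero_of_mem_specht_of_proj_eq_zero {n k : ℕ} (hk : k ≤ n) {y : GroupAlg n}
    (hy : y ∈ specht n k) (h0 : proj n k hk y = 0) : y = 0 := by
  classical
  refine MonoidAlgebra.coeff_injective (Finsupp.ext fun g => ?_)
  have h1 := congrFun h0 (g • lastSubset n k hk)
  rw [proj_apply, ← Equiv.sum_comp (Equiv.mulLeft g), Set.powersetCard.coe_smul, coe_lastSubset]
    at h1
  have h2 : ∀ p : Perm (Fin n), (y.coeff (Equiv.mulLeft g p) *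
      if Equiv.mulLeft g p • lastFinset n k = g • lastFinset n k then 1 else 0) =
      if p ∈ rowSubgroup n k then y.coeff g else 0 := by
    intro p
    rw [Equiv.coe_mulLeft, mul_smul]
    simp only [smul_left_cancel_iff, ← rowSubgroup_smul_lastFinset]
    split_ifs with hp
    · rw [coeff_mul_of_mem_specht hy hp, mul_one]
    · rw [mul_zero]
  rw [Finset.sum_congr rfl fun p _ => h2 p, ← Finset.sum_filter, Finset.sum_const, nsmul_eq_mul,
    Pi.zero_apply, mul_eq_zero, Nat.cast_eq_zero, Finset.card_eq_zero] at h1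
  refine h1.resolve_left fun h => ?_
  have : (1 : Perm (Fin n)) ∈ (∅ : Finset (Perm (Fin n))) := by
    rw [← h]; simp [one_mem]
  simp at this

/-- The linear map `M^{(n-m,m)} → M^{(n-k,k)}` summing over the `m`-subsets that contain a given
`k`-subset. -/
def sumSupersets (n m k : ℕ) : PermMod n m →ₗ[ℂ] PermMod n k where
  toFun f ρ := ∑ σ : Set.powersetCard (Fin n) m,
    (if (ρ : Finset (Fin n)) ⊆ (σ : Finset (Fin n)) then 1 else 0) * f σ
  map_add' f g := by ext ρ; simp [mul_add, Finset.sum_add_distrib]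
  map_smul' c f := by ext ρ; simp [Finset.mul_sum]

theorem sumSupersets_apply {n m k : ℕ} (f : PermMod n m) (ρ : Set.powersetCard (Fin n) k) :
    sumSupersets n m k f ρ = ∑ σ : Set.powersetCard (Fin n) m,
      (if (ρ : Finset (Fin n)) ⊆ (σ : Finset (Fin n)) then 1 else 0) * f σ := rfl

/-- The lower index `n - m`, rather than `m - A.card`, makes the formula give `0` when `A` has more
than `m` elements. -/
theorem card_supersets {n m : ℕ} (hm : m ≤ n) (A : Finset (Fin n)) :
    ∑ σ : Set.powersetCard (Fin n) m, (if A ⊆ (σ : Finset (Fin n)) then (1 : ℂ) else 0) =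
      ((n - A.card).choose (n - m) : ℂ) := by
  have hA := A.card_le_univ
  rw [Fintype.card_fin] at hA
  rcases le_or_gt A.card m with h | h
  · rw [sum_setPowersetCard_of_subset A h fun _ => 1, Finset.sum_const, Finset.card_powersetCard,
      Finset.card_compl, Fintype.card_fin, nsmul_one,
      ← Nat.choose_symm_of_eq_add (show n - A.card = (n - m) + (m - A.card) by omega)]
  · rw [Nat.choose_eq_zero_of_lt (by omega), Nat.cast_zero]
    refine Finset.sum_eq_zero fun σ _ => if_neg fun hσ => ?_
    have := Finset.card_le_card hσ
    rw [Set.powersetCard.card_eq] at this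
    omega

/-- Apply `sum_mul_polytabloid` to the inclusion kernel. If `qρ` meets the second row in `j` points,
their union has `2k - j` elements and `(n - 2k + j).choose (n - m)` supersets of size `m`. The
`k`-th difference in `j` is `(n - 2k).choose (n - m - k)`, which is positive because `k ≤ m`. -/
theorem exists_sumSupersets_proj_youngSymm {n m k : ℕ} [NeZero n] (hk : k ≤ m) (hmk : m + k ≤ n) :
    ∃ c : ℂ, c ≠ 0 ∧ sumSupersets n m k (proj n m (by omega) (youngSymm n k)) =
      c • proj n k (by omega) (youngSymm n k) := by
  have h : 2 * k ≤ n := by omega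
  obtain ⟨N, hN0, hN⟩ := exists_proj_youngSymm hk (by omega) h
  obtain ⟨N', hN0', hN'⟩ := exists_proj_youngSymm (le_refl k) (by omega) h
  have hN0c : (N : ℂ) ≠ 0 := Nat.cast_ne_zero.2 hN0
  have hN0c' : (N' : ℂ) ≠ 0 := Nat.cast_ne_zero.2 hN0'
  refine ⟨N / N' * ((n - 2 * k).choose (n - m - k) : ℂ), ?_, ?_⟩
  · have : (n - 2 * k).choose (n - m - k) ≠ 0 := (Nat.choose_pos (by omega)).ne'
    exact mul_ne_zero (div_ne_zero hN0c hN0c') (Nat.cast_ne_zero.2 this)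
  · ext ρ
    have hg : ∀ q : Perm (Fin n), ∑ σ : Set.powersetCard (Fin n) m,
        (if lastFinset n k ⊆ (σ : Finset (Fin n)) then
          (if (q • (ρ : Finset (Fin n))) ⊆ (σ : Finset (Fin n)) then (1 : ℂ) else 0) else 0) =
        (fun j => ((n - 2 * k + j).choose (n - m) : ℂ))
          ((q • (ρ : Finset (Fin n))) ∩ lastFinset n k).card := by
      intro q
      have hc := Finset.card_union_add_card_inter (q • (ρ : Finset (Fin n))) (lastFinset n k)
      rw [card_lastFinset (by omega), Finset.card_smul_finset, Set.powersetCard.card_eq] at hc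
      have hle : ((q • (ρ : Finset (Fin n))) ∩ lastFinset n k).card ≤ k :=
        (Finset.card_le_card Finset.inter_subset_right).trans_eq (card_lastFinset (by omega))
      dsimp only
      rw [show n - 2 * k + ((q • (ρ : Finset (Fin n))) ∩ lastFinset n k).card =
        n - ((q • (ρ : Finset (Fin n))) ∪ lastFinset n k).card by omega, ← card_supersets (by omega)]
      refine Finset.sum_congr rfl fun σ _ => ?_
      simp only [Finset.union_subset_iff, ite_and]
      split_ifs <;> rfl
    have := sum_mul_polytabloid (m := m) h (fun ρ σ => if ρ ⊆ σ then 1 else 0)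
      (fun q ρ σ => by simp only [Finset.smul_finset_subset_smul_finset_iff])
      (fun j => ((n - 2 * k + j).choose (n - m) : ℂ)) (ρ : Finset (Fin n)) hg
    have hb : binomDiff k (fun j => ((n - 2 * k + j).choose (n - m) : ℂ)) =
        ((n - 2 * k).choose (n - m - k) : ℂ) :=
      sum_range_neg_one_pow_choose_choose k (n - 2 * k) (n - m) (by omega)
    rw [hb] at this
    rw [sumSupersets_apply, Pi.smul_apply, hN', smul_eq_mul]
    simp only [hN]
    rw [show (N / N' * ((n - 2 * k).choose (n - m - k) : ℂ)) * (N' * polytabloid h (ρ : Finset _)) =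
      N * (polytabloid h (ρ : Finset _) * ((n - 2 * k).choose (n - m - k) : ℂ)) by
        field_simp, ← this, Finset.mul_sum]
    exact Finset.sum_congr rfl fun σ _ => by ring

/-- Both maps commute with the left action of `S_n`, so an identity at the generator `c_k` spreads
to the left ideal it generates. -/
theorem sumSupersets_proj_mul {n m k : ℕ} (hm : m ≤ n) (hk : k ≤ n) {y : GroupAlg n} {c : ℂ}
    (hc : sumSupersets n m k (proj n m hm y) = c • proj n k hk y) (x : GroupAlg n) :
    sumSupersets n m k (proj n m hm (x * y)) = c • proj n k hk (x * y) := by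
  induction x using MonoidAlgebra.induction_linear with
  | zero => simp
  | add x z hx hz => rw [add_mul, map_add, map_add, map_add, smul_add, hx, hz]
  | single g a =>
    have ha : (MonoidAlgebra.single g a : GroupAlg n) * y = a • (MonoidAlgebra.single g 1 * y) := by
      rw [← smul_mul_assoc, MonoidAlgebra.smul_single, smul_eq_mul, mul_one]
    rw [ha, map_smul, map_smul, map_smul, smul_comm c a]
    congr 1
    ext ρ
    rw [sumSupersets_apply, Pi.smul_apply, proj_single_mul]
    have h1 := congrFun hc (g⁻¹ • ρ)
    rw [Pi.smul_apply, sumSupersets_apply] at h1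
    rw [← h1, ← Equiv.sum_comp (MulAction.toPerm g : Perm (Set.powersetCard (Fin n) m))]
    refine Finset.sum_congr rfl fun σ _ => ?_
    rw [proj_single_mul, MulAction.toPerm_apply, inv_smul_smul, Set.powersetCard.coe_smul,
      Set.powersetCard.coe_smul]
    simp only [Finset.subset_smul_finset_iff]

/-- On the Specht module, the projection to `m`-sets followed by `sumSupersets` is a nonzero
multiple of the projection to `k`-sets, which is injective there. -/
theorem proj_injOn_specht {n m k : ℕ} [NeZero n] (hk : k ≤ m) (hmk : m + k ≤ n) {y : GroupAlg n}
    (hy : y ∈ specht n k) (h0 : proj n m (by omega) y = 0) : y = 0 := by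
  obtain ⟨c, hc0, hc⟩ := exists_sumSupersets_proj_youngSymm hk hmk
  obtain ⟨x, rfl⟩ := id hy
  have := sumSupersets_proj_mul _ _ hc x
  rw [LinearMap.mulRight_apply] at h0
  rw [h0, map_zero, eq_comm, smul_eq_zero] at this
  exact eq_zero_of_mem_specht_of_proj_eq_zero _ hy (this.resolve_left hc0)

/-- The copy of the Specht module `S^{(n-k,k)}` in `M^{(n-m,m)}`. -/
noncomputable def spechtImage (n m k : ℕ) (hm : m ≤ n) : Submodule ℂ (PermMod n m) :=
  (specht n k).map (proj n m hm)

theorem finrank_spechtImage {n m k : ℕ} [NeZero n] (hk : k ≤ m) (hmk : m + k ≤ n) :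
    Module.finrank ℂ (spechtImage n m k (by omega)) = spechtDim n k := by
  have hinj : Function.Injective ((proj n m (by omega)).domRestrict (specht n k)) := by
    rw [← LinearMap.ker_eq_bot, LinearMap.ker_eq_bot']
    intro y hy
    exact Subtype.ext (proj_injOn_specht hk hmk y.2 hy)
  rw [spechtImage, spechtDim, ← LinearMap.finrank_range_of_inj hinj, LinearMap.range_domRestrict]

/-- The entries of `B` are invariant under simultaneous permutation of row and column, so the
eigenvalue equation passes to the left ideal generated by `y`. -/
theorem intertwiner_mulVec_smul {n m : ℕ} (hm : m ≤ n) {y : GroupAlg n} {c : ℂ} {b : ℕ → ℂ}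
    (hc : (intertwiner n m b).mulVec (proj n m hm y) = c • proj n m hm y) (x : GroupAlg n) :
    (intertwiner n m b).mulVec (proj n m hm (x * y)) = c • proj n m hm (x * y) := by
  induction x using MonoidAlgebra.induction_linear with
  | zero => simp
  | add x z hx hz => rw [add_mul, map_add, Matrix.mulVec_add, smul_add, hx, hz]
  | single g a =>
    have ha : (MonoidAlgebra.single g a : GroupAlg n) * y = a • (MonoidAlgebra.single g 1 * y) := by
      rw [← smul_mul_assoc, MonoidAlgebra.smul_single, smul_eq_mul, mul_one]
    rw [ha, map_smul, Matrix.mulVec_smul, smul_comm c a]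
    congr 1
    ext ρ
    rw [Matrix.mulVec, dotProduct, Pi.smul_apply, proj_single_mul]
    have h1 := congrFun hc (g⁻¹ • ρ)
    rw [Pi.smul_apply, Matrix.mulVec, dotProduct] at h1
    rw [← h1, ← Equiv.sum_comp (MulAction.toPerm g : Perm (Set.powersetCard (Fin n) m))]
    refine Finset.sum_congr rfl fun σ _ => ?_
    rw [proj_single_mul, MulAction.toPerm_apply, inv_smul_smul, intertwiner, Matrix.of_apply,
      Matrix.of_apply, Set.powersetCard.coe_smul, Set.powersetCard.coe_smul,
      ← Finset.card_smul_finset g (g⁻¹ • (ρ : Finset (Fin n)) ∩ _), Finset.smul_finset_inter, smul_inv_smul]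

theorem intertwiner_mulVec_of_mem_spechtImage {n k m : ℕ} [NeZero n] (hk : k ≤ m) (hm : m ≤ n)
    (hmk : m + k ≤ n) (b : ℕ → ℂ) {v : PermMod n m} (hv : v ∈ spechtImage n m k hm) :
    (intertwiner n m b).mulVec v = eigval n m k b • v := by
  obtain ⟨_, ⟨x, rfl⟩, rfl⟩ := hv
  exact intertwiner_mulVec_smul hm (intertwiner_mulVec_proj_youngSymm hk hm hmk b) x

/-! ### The Specht images span -/

/-- Any `k` disjoint pairs are the two-entry columns of some translate of `T_k`, so vanishing on all
translates of `π(c_k)` gives the difference conditions for arbitrary pairs. -/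
theorem exists_perm_extend_rows {n k : ℕ} [NeZero n] (h : 2 * k ≤ n) {a b : ℕ → Fin n}
    (ha : Set.InjOn a (Finset.range k)) (hb : Set.InjOn b (Finset.range k))
    (hab : ∀ i < k, ∀ j < k, a i ≠ b j) :
    ∃ g : Perm (Fin n), ∀ i < k, g (Fin.ofNat n (n - k + i)) = a i ∧ g (Fin.ofNat n i) = b i := by
  let f : Fin n → Fin n := fun x => if (x : ℕ) < k then b x else a (x - (n - k))
  obtain ⟨g, hg⟩ := Finset.exists_equiv_extend_of_card_eq (t := (Finset.univ : Finset (Fin n)))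
    (s := Finset.univ.filter fun x : Fin n => (x : ℕ) < k ∨ n - k ≤ (x : ℕ)) (f := f) (by simp)
    (by simp) (by
      intro x hx y hy hxy
      simp only [Finset.coe_filter, Finset.mem_univ, true_and, Set.mem_ofPred_eq] at hx hy
      have hmem : ∀ i, i < k → i ∈ (Finset.range k : Set ℕ) := by simp
      simp only [f] at hxy
      split_ifs at hxy with h1 h2 h2
      · exact Fin.ext (hb (hmem _ h1) (hmem _ h2) hxy)
      · exact absurd hxy.symm (hab _ (by omega) _ h1)
      · exact absurd hxy (hab _ (by omega) _ h2)
      · have := ha (hmem _ (by omega)) (hmem _ (by omega)) hxy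
        ext; omega)
  refine ⟨g.trans (Equiv.subtypeUnivEquiv Finset.mem_univ), fun i hi => ⟨?_, ?_⟩⟩
  · have hv : (Fin.ofNat n (n - k + i) : ℕ) = n - k + i := Nat.mod_eq_of_lt (by omega)
    refine (hg _ ?_).trans ?_
    · rw [Finset.mem_filter, hv]; exact ⟨Finset.mem_univ _, by omega⟩
    · simp only [f]
      rw [hv, if_neg (by omega), Nat.add_sub_cancel_left]
  · have hv : (Fin.ofNat n i : ℕ) = i := Nat.mod_eq_of_lt (by omega)
    refine (hg _ ?_).trans ?_
    · rw [Finset.mem_filter, hv]; exact ⟨Finset.mem_univ _, by omega⟩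
    · simp only [f]
      rw [hv, if_pos hi]

/-- Double counting: an `m`-set `σ ⊇ ρ` arises from `m - ρ.card` choices of `c`. This turns
vanishing of superset sums on `k`-sets into the sum condition on `(k+1)`-sets. -/
theorem sum_insert_supersets {n m : ℕ} (F : Set.powersetCard (Fin n) m → ℂ)
    (ρ : Finset (Fin n)) :
    ∑ c ∈ Finset.univ \ ρ, ∑ σ : Set.powersetCard (Fin n) m,
      (if insert c ρ ⊆ (σ : Finset (Fin n)) then F σ else 0) =
    ((m - ρ.card : ℕ) : ℂ) * ∑ σ : Set.powersetCard (Fin n) m,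
      (if ρ ⊆ (σ : Finset (Fin n)) then F σ else 0) := by
  rw [Finset.sum_comm, Finset.mul_sum]
  refine Finset.sum_congr rfl fun σ _ => ?_
  split_ifs with h
  · simp only [Finset.insert_subset_iff, h, and_true]
    rw [← Finset.sum_filter, Finset.sum_const, nsmul_eq_mul]
    congr 2
    have : ((Finset.univ \ ρ).filter fun c => c ∈ (σ : Finset (Fin n))) =
        (σ : Finset (Fin n)) \ ρ := by
      ext c; simp [and_comm]
    rw [this, Finset.card_sdiff_of_subset h, Set.powersetCard.card_eq]
  · simp only [Finset.insert_subset_iff, h, and_false, if_false, Finset.sum_const_zero, mul_zero]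

theorem iSup_spechtImage {n m : ℕ} [NeZero n] (hm : m ≤ n) (h2m : 2 * m ≤ n) :
    ⨆ k : Fin (m + 1), spechtImage n m k hm = ⊤ := by
  classical
  by_contra hne
  obtain ⟨φ, hφ0, hφ⟩ := Submodule.exists_le_ker_of_lt_top _ (lt_top_iff_ne_top.2 hne)
  have hφk : ∀ k ≤ m, ∀ x : GroupAlg n, φ (proj n m hm (x * youngSymm n k)) = 0 := by
    intro k hk x
    refine hφ (Submodule.mem_iSup_of_mem ⟨k, Nat.lt_succ_of_le hk⟩ ?_)
    exact ⟨_, ⟨x, rfl⟩, rfl⟩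
  let F : Set.powersetCard (Fin n) m → ℂ := fun σ => φ (Pi.single σ 1)
  have hφF : ∀ v : PermMod n m, φ v = ∑ σ, v σ * F σ := by
    intro v
    rw [LinearMap.pi_apply_eq_sum_univ φ v]
    refine Finset.sum_congr rfl fun σ _ => ?_
    rw [smul_eq_mul]
    congr 2
    ext τ
    rw [Pi.single_apply]
    exact if_congr eq_comm rfl rfl
  -- `F` holds the coordinates of a functional killing every Specht image. Its superset sums `G` are
  -- to vanish on sets of each size up to `m`.
  let G : Finset (Fin n) → ℂ := fun ρ => ∑ σ : Set.powersetCard (Fin n) m,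
    if ρ ⊆ (σ : Finset (Fin n)) then F σ else 0
  -- This is the vanishing of `φ` on the translate of `π(c_k)` by `g`, divided by `N` and with the
  -- two sums exchanged.
  have hdiff : ∀ k ≤ m, ∀ (h : 2 * k ≤ n) (g : Perm (Fin n)), ∑ S ∈ (Finset.range k).powerset,
      (-1) ^ S.card * G (g • colPerm h S • lastFinset n k) = 0 := by
    intro k hk h g
    obtain ⟨N, hN0, hN⟩ := exists_proj_youngSymm hk hm h
    have h1 := hφk k hk (MonoidAlgebra.single g 1)
    rw [hφF] at h1
    simp only [proj_single_mul, hN, mul_assoc] at h1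
    rw [← Finset.mul_sum, mul_eq_zero, Nat.cast_eq_zero] at h1
    rw [← h1.resolve_left hN0]
    simp only [polytabloid, Finset.sum_mul, G]
    rw [Finset.sum_comm]
    refine Finset.sum_congr rfl fun S _ => ?_
    rw [Finset.mul_sum]
    refine Finset.sum_congr rfl fun σ _ => ?_
    rw [Set.powersetCard.coe_smul, mul_assoc]
    congr 1
    rw [ite_mul, one_mul, zero_mul]
    refine if_congr ?_ rfl rfl
    nth_rewrite 2 [← colPerm_inv]
    rw [Finset.subset_smul_finset_iff, inv_inv, Finset.subset_smul_finset_iff, inv_inv]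
  have hstep : ∀ k ≤ m, (∀ ρ ⊆ Finset.univ, ρ.card + 1 = k →
      ∑ c ∈ Finset.univ \ ρ, G (insert c ρ) = 0) → ∀ ρ : Finset (Fin n), ρ.card = k → G ρ = 0 := by
    intro k hk hD ρ hρ
    have h : 2 * k ≤ n := by omega
    refine eq_zero_of_sum_insert_eq_zero_of_differences k Finset.univ G (by simpa using h) hD ?_ ρ
      (Finset.subset_univ _) hρ
    intro a b ha hb hab _
    obtain ⟨g, hg⟩ := exists_perm_extend_rows h ha hb hab
    rw [← hdiff k hk h g]
    refine Finset.sum_congr rfl fun S hS => ?_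
    rw [Finset.mem_powerset] at hS
    rw [colPerm_smul_lastFinset h S hS, Finset.smul_finset_union]
    simp only [Finset.smul_finset_def, Finset.image_image]
    congr 3
    · refine Finset.image_congr fun i hi => ?_
      exact ((hg i (by simpa using (Finset.mem_sdiff.1 hi).1)).1).symm
    · refine Finset.image_congr fun i hi => ?_
      exact ((hg i (by simpa using hS hi)).2).symm
  have hG : ∀ k ≤ m, ∀ ρ : Finset (Fin n), ρ.card = k → G ρ = 0 := by
    intro k
    induction k with
    | zero => exact fun hk => hstep 0 hk fun ρ _ hρ => by omega
    | succ k ih =>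
      exact fun hk => hstep (k + 1) hk fun ρ _ hρ => by
        simp only [G]
        rw [sum_insert_supersets]
        have := ih (by omega) ρ (by omega)
        simp only [G] at this
        rw [this, mul_zero]
  refine hφ0 (LinearMap.ext fun v => ?_)
  rw [hφF, LinearMap.zero_apply]
  refine Finset.sum_eq_zero fun σ _ => ?_
  -- An `m`-set is its own only superset of size `m`, so on `m`-sets `G` is `F`.
  have h1 := hG m le_rfl σ (by simp)
  simp only [G] at h1
  rw [Finset.sum_eq_single σ, if_pos subset_rfl] at h1
  · rw [h1, mul_zero]
  · intro τ _ hτ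
    exact if_neg fun h => hτ (Set.powersetCard.eq_iff_subset.2 h).symm
  · simp

/-! ### Generic distinctness of the eigenvalues -/

/-- For this `b`, `B` is the adjacency matrix of the Johnson graph. Only `j + p = m - 1` counts, and
`p ≤ m - k` leaves `j = k` and `j = k - 1`. For `m = 0` the truncated `m - 1` would select the
diagonal instead. -/
theorem eigval_johnson {n m k : ℕ} (hm : 0 < m) (hk : k ≤ m) (hmk : m + k ≤ n) :
    eigval n m k (fun p => if p = m - 1 then 1 else 0) =
      (m : ℂ) * (n - m) - k * (n + 1 - k) := by
  have inner : ∀ j ≤ k, ∀ c : ℂ, ∑ p ∈ Finset.range (m - k + 1), c * ((m - j).choose p : ℂ) *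
      ((n - m - k + j).choose (m - k - p) : ℂ) * (if j + p = m - 1 then 1 else 0) =
      c * if j = k then ((m : ℂ) - k) * (n - m) else if j + 1 = k then (m : ℂ) - k + 1 else 0 := by
    intro j hj c
    by_cases hjk : j = k
    · subst hjk
      rw [if_pos rfl]
      rcases hk.eq_or_lt with rfl | h
      · simp; omega
      · rw [Finset.sum_eq_single (m - j - 1)]
        · rw [if_pos (by omega), Nat.choose_symm_of_eq_add (show m - j = (m - j - 1) + 1 by omega),
            show m - j - (m - j - 1) = 1 by omega, show n - m - j + j = n - m by omega,
            Nat.choose_one_right, Nat.choose_one_right, Nat.cast_sub (by omega),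
            Nat.cast_sub (by omega)]
          ring
        · intro p _ hp
          rw [if_neg (by omega), mul_zero]
        · intro h
          simp at h
    · rw [if_neg hjk]
      by_cases hjk1 : j + 1 = k
      · rw [if_pos hjk1, Finset.sum_eq_single (m - k)]
        · rw [if_pos (by omega), Nat.choose_symm_of_eq_add (show m - j = (m - k) + 1 by omega),
            Nat.choose_one_right, Nat.sub_self, Nat.choose_zero_right,
            show m - j = m - k + 1 by omega, Nat.cast_add, Nat.cast_sub (by omega)]
          push_cast
          ring
        · intro p _ hp
          rw [if_neg (by omega), mul_zero]
        · intro h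
          simp at h
      · rw [if_neg hjk1, mul_zero]
        refine Finset.sum_eq_zero fun p hp => ?_
        have := Finset.mem_range.1 hp
        rw [if_neg (by omega), mul_zero]
  unfold eigval
  rw [Finset.sum_congr rfl fun j hj => inner j (by simpa [Nat.lt_succ_iff] using hj) _,
    Finset.sum_range_succ]
  rcases k with _ | k
  · simp
  · rw [Finset.sum_range_succ, Finset.sum_eq_zero]
    · simp
      ring
    · intro j hj
      have := Finset.mem_range.1 hj
      rw [if_neg (by omega), if_neg (by omega), mul_zero]

theorem exists_injOn_eigval {n m : ℕ} (h2m : 2 * m ≤ n) :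
    ∃ b : ℕ → ℂ, Set.InjOn (fun k => eigval n m k b) (Set.Iic m) := by
  rcases Nat.eq_zero_or_pos m with rfl | hm
  · refine ⟨0, fun k hk l hl _ => ?_⟩
    rw [Set.mem_Iic] at hk hl
    omega
  · refine ⟨fun p => if p = m - 1 then 1 else 0, fun k hk l hl hkl => ?_⟩
    rw [Set.mem_Iic] at hk hl
    dsimp only at hkl
    rw [eigval_johnson hm hk (by omega), eigval_johnson hm hl (by omega)] at hkl
    -- The second factor cannot vanish, since `k + l ≤ 2m ≤ n`.
    have h0 : ((k : ℂ) - l) * (n + 1 - (k + l)) = 0 := by linear_combination -hkl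
    rcases mul_eq_zero.1 h0 with h | h
    · exact_mod_cast sub_eq_zero.1 h
    · have : n + 1 = k + l := by exact_mod_cast sub_eq_zero.1 h
      omega

/-- The eigenvalue `λ_k` as a linear form in `b_0, …, b_m`. -/
noncomputable def eigvalPoly (n m k : ℕ) : MvPolynomial (Fin (m + 1)) ℂ :=
  ∑ j ∈ Finset.range (k + 1), ∑ p ∈ Finset.range (m - k + 1),
    MvPolynomial.C ((-1) ^ (k - j) * (k.choose j : ℂ) * ((m - j).choose p : ℂ) *
      ((n - m - k + j).choose (m - k - p) : ℂ)) * MvPolynomial.X (Fin.ofNat (m + 1) (j + p))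

theorem eval_eigvalPoly {n m k : ℕ} (hk : k ≤ m) (b : ℕ → ℂ) :
    MvPolynomial.eval (fun i : Fin (m + 1) => b i) (eigvalPoly n m k) = eigval n m k b := by
  unfold eigvalPoly eigval
  simp only [map_sum, map_mul, MvPolynomial.eval_C, MvPolynomial.eval_X]
  refine Finset.sum_congr rfl fun j hj => Finset.sum_congr rfl fun p hp => ?_
  rw [Finset.mem_range] at hj hp
  have : (Fin.ofNat (m + 1) (j + p) : ℕ) = j + p := Nat.mod_eq_of_lt (by omega)
  rw [this]

/-- The polynomial is the product of all differences `λ_k - λ_l` with `l < k`. It is nonzero because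
it does not vanish at the `b` of `exists_injOn_eigval`. -/
theorem exists_generic_polynomial {n m : ℕ} (h2m : 2 * m ≤ n) :
    ∃ P : MvPolynomial (Fin (m + 1)) ℂ, P ≠ 0 ∧
      ∀ b : ℕ → ℂ, MvPolynomial.eval (fun i : Fin (m + 1) => b i) P ≠ 0 →
        Set.InjOn (fun k => eigval n m k b) (Set.Iic m) := by
  have heval : ∀ b : ℕ → ℂ, MvPolynomial.eval (fun i : Fin (m + 1) => b i)
      (∏ k ∈ Finset.range (m + 1), ∏ l ∈ Finset.range k, (eigvalPoly n m k - eigvalPoly n m l)) =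
      ∏ k ∈ Finset.range (m + 1), ∏ l ∈ Finset.range k, (eigval n m k b - eigval n m l b) := by
    intro b
    simp only [map_prod, map_sub]
    refine Finset.prod_congr rfl fun k hk => Finset.prod_congr rfl fun l hl => ?_
    rw [Finset.mem_range] at hk hl
    rw [eval_eigvalPoly (by omega), eval_eigvalPoly (by omega)]
  refine ⟨∏ k ∈ Finset.range (m + 1), ∏ l ∈ Finset.range k,
    (eigvalPoly n m k - eigvalPoly n m l), ?_, fun b hb => ?_⟩
  · obtain ⟨b, hb⟩ := exists_injOn_eigval h2m
    intro h0
    have h1 := heval b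
    rw [h0, map_zero, eq_comm, Finset.prod_eq_zero_iff] at h1
    obtain ⟨k, hk, h1⟩ := h1
    obtain ⟨l, hl, h1⟩ := Finset.prod_eq_zero_iff.1 h1
    rw [Finset.mem_range] at hk hl
    have := hb (Set.mem_Iic.2 (by omega)) (Set.mem_Iic.2 (by omega)) (sub_eq_zero.1 h1)
    omega
  · rw [heval] at hb
    have hlt : ∀ k ≤ m, ∀ l < k, eigval n m k b ≠ eigval n m l b := by
      intro k hk l hl hkl
      refine hb (Finset.prod_eq_zero (Finset.mem_range.2 (Nat.lt_succ_of_le hk))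
        (Finset.prod_eq_zero (Finset.mem_range.2 hl) (sub_eq_zero.2 hkl)))
    intro k hk l hl hkl
    rcases lt_trichotomy k l with h | h | h
    · exact absurd hkl.symm (hlt l hl k h)
    · exact h
    · exact absurd hkl (hlt k hk l h)

/-! ### The decomposition and the spectrum of `B` -/

/-- Independence needs only one `b` with distinct `λ_k`, as the images then lie in different
eigenspaces. The decomposition does not involve `b`, so it serves every `b`, including those with
coinciding eigenvalues. -/
theorem isInternal_spechtImage {n m : ℕ} [NeZero n] (hm : m ≤ n) (h2m : 2 * m ≤ n) :
    DirectSum.IsInternal fun k : Fin (m + 1) => spechtImage n m k hm := by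
  classical
  obtain ⟨b, hb⟩ := exists_injOn_eigval h2m
  refine DirectSum.isInternal_submodule_of_iSupIndep_of_iSup_eq_top ?_ (iSup_spechtImage hm h2m)
  have hinj : Function.Injective fun k : Fin (m + 1) => eigval n m k b := by
    intro k l hkl
    exact Fin.ext (hb (Nat.lt_succ_iff.1 k.2) (Nat.lt_succ_iff.1 l.2) hkl)
  refine ((Module.End.eigenspaces_iSupIndep (Matrix.toLin' (intertwiner n m b))).comp hinj).mono ?_
  intro k v hv
  have hk := k.2
  rw [Function.comp_apply, Module.End.mem_eigenspace_iff, Matrix.toLin'_apply]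
  exact intertwiner_mulVec_of_mem_spechtImage (by omega) hm (by omega) b hv

/-- A basis of `M^{(n-m,m)}` adapted to its decomposition into Specht modules. -/
theorem exists_basis_eigenvectors {n m : ℕ} [NeZero n] (h2m : 2 * m ≤ n) :
    ∃ e : Module.Basis (Σ k : Fin (m + 1), Fin (spechtDim n k)) ℂ (PermMod n m),
      ∀ (b : ℕ → ℂ) i, (intertwiner n m b).mulVec (e i) = eigval n m i.1 b • e i := by
  have hm : m ≤ n := by omega
  have hint := isInternal_spechtImage hm h2m
  refine ⟨hint.collectedBasis fun k => Module.finBasisOfFinrankEq ℂ (spechtImage n m k hm)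
    (finrank_spechtImage (Nat.lt_succ_iff.1 k.2) (by have := k.2; omega)), fun b i => ?_⟩
  have hk := i.1.2
  exact intertwiner_mulVec_of_mem_spechtImage (by omega) hm (by omega) b
    (hint.collectedBasis_mem _ i)

theorem sum_spechtDim {n m : ℕ} [NeZero n] (h2m : 2 * m ≤ n) :
    ∑ k ∈ Finset.range (m + 1), spechtDim n k = n.choose m := by
  obtain ⟨e, -⟩ := exists_basis_eigenvectors h2m
  have h1 := Module.finrank_eq_card_basis e
  rw [Module.finrank_fintype_fun_eq_card, Fintype.card_sigma] at h1
  simp only [Fintype.card_fin] at h1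
  rw [Finset.sum_range fun k => spechtDim n k, ← h1, ← Nat.card_eq_fintype_card,
    Set.powersetCard.card, Nat.card_eq_fintype_card, Fintype.card_fin]

theorem charpoly_intertwiner {n m : ℕ} [NeZero n] [DecidableEq (Set.powersetCard (Fin n) m)]
    (h2m : 2 * m ≤ n) (b : ℕ → ℂ) :
    (intertwiner n m b).charpoly = ∏ k ∈ Finset.range (m + 1),
      (Polynomial.X - Polynomial.C (eigval n m k b)) ^ spechtDim n k := by
  obtain ⟨e, he⟩ := exists_basis_eigenvectors h2m
  rw [← Matrix.charpoly_toLin', charpoly_eq_prod_of_eigenbasis e _ (fun i => eigval n m i.1 b)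
    (fun i => by rw [Matrix.toLin'_apply]; exact he b i), Fintype.prod_sigma, Finset.prod_range]
  simp

open scoped Classical in
theorem finrank_eigenspace_intertwiner {n m : ℕ} [NeZero n]
    (h2m : 2 * m ≤ n) (b : ℕ → ℂ) (μ : ℂ) :
    Module.finrank ℂ (Module.End.eigenspace (Matrix.toLin' (intertwiner n m b)) μ) =
      ∑ l ∈ Finset.range (m + 1) with eigval n m l b = μ, spechtDim n l := by
  obtain ⟨e, he⟩ := exists_basis_eigenvectors h2m
  rw [finrank_eigenspace_of_eigenbasis e _ (fun i => eigval n m i.1 b)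
    (fun i => by rw [Matrix.toLin'_apply]; exact he b i), Finset.card_filter, Fintype.sum_sigma,
    Finset.sum_filter, Finset.sum_range]
  refine Finset.sum_congr rfl fun k _ => ?_
  by_cases h : eigval n m k b = μ <;> simp [h]

/-! ### Dimensions of the Specht modules -/

theorem spechtDim_zero {n : ℕ} [NeZero n] : spechtDim n 0 = 1 := by
  simpa using sum_spechtDim (n := n) (m := 0) (by omega)

/-- Subtract the dimension counts for `m = k + 1` and `m = k`. -/
theorem spechtDim_succ {n k : ℕ} [NeZero n] (h : 2 * (k + 1) ≤ n) :
    spechtDim n (k + 1) + n.choose k = n.choose (k + 1) := by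
  rw [← sum_spechtDim h, ← sum_spechtDim (show 2 * k ≤ n by omega),
    Finset.sum_range_succ _ (k + 1), add_comm]

theorem spechtDim_eq_div {n k : ℕ} [NeZero n] (h : 2 * k ≤ n) :
    (spechtDim n k : ℚ) = (n.factorial : ℚ) * ((n : ℚ) - 2 * k + 1) /
      ((k.factorial : ℚ) * ((n - k + 1).factorial : ℚ)) := by
  rw [eq_div_iff (by positivity)]
  rcases k with _ | k
  · rw [spechtDim_zero, Nat.sub_zero, Nat.factorial_succ]
    push_cast
    simp
    ring
  · have h1 : (spechtDim n (k + 1) : ℚ) = n.choose (k + 1) - n.choose k := by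
      rw [← spechtDim_succ h]; push_cast; ring
    have h2 := Nat.choose_mul_factorial_mul_factorial (show k + 1 ≤ n by omega)
    have h3 := Nat.choose_mul_factorial_mul_factorial (show k ≤ n by omega)
    obtain ⟨r, rfl⟩ := Nat.exists_eq_add_of_le' (show k + 1 ≤ n by omega)
    rw [show r + (k + 1) - k = r + 1 by omega] at h3
    rw [show r + (k + 1) - (k + 1) = r by omega] at h2 ⊢
    rw [h1]
    have h2' : ((r + (k + 1)).choose (k + 1) : ℚ) * (k + 1).factorial * r.factorial =
      (r + (k + 1)).factorial := by exact_mod_cast h2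
    have h3' : ((r + (k + 1)).choose k : ℚ) * k.factorial * (r + 1).factorial =
      (r + (k + 1)).factorial := by exact_mod_cast h3
    have e1 : ((k + 1).factorial : ℚ) = (k + 1) * k.factorial := by
      rw [Nat.factorial_succ]; push_cast; ring
    have e2 : ((r + 1).factorial : ℚ) = (r + 1) * r.factorial := by
      rw [Nat.factorial_succ]; push_cast; ring
    rw [e1] at h2' ⊢
    rw [e2] at h3' ⊢
    push_cast at h2' h3' ⊢
    -- After clearing denominators the two binomials give `(r + 1) n!` and `(k + 1) n!`, where `n =
    -- r + k + 1`, and `r - k = n - 2(k + 1) + 1`.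
    linear_combination (r + 1 : ℚ) * h2' - (k + 1 : ℚ) * h3'

theorem spechtDim_eq_sub {n k : ℕ} [NeZero n] (h : 2 * k ≤ n) :
    (spechtDim n k : ℤ) = (n.choose k : ℤ) - (if k = 0 then 0 else (n.choose (k - 1) : ℤ)) := by
  rcases k with _ | k
  · simp [spechtDim_zero]
  · rw [← spechtDim_succ h]
    simp

end SubsetRep

/-! ### The main theorem -/

open SubsetRep in
open Classical in
theorem theorem1 (n m : ℕ) (hn : 0 < n) (hm : m ≤ n / 2) :
    -- `π(c_k)` is an eigenvector with eigenvalue `λ_k`, for every choice of `b`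
    (∀ b : ℕ → ℂ, ∀ k ≤ m,
      Module.End.HasEigenvector (Matrix.toLin' (intertwiner n m b)) (eigval n m k b)
        (proj n m (by omega) (youngSymm n k))) ∧
    -- for generic `b_0, …, b_m` the `λ_k` are distinct, of geometric and algebraic
    -- multiplicity `f^{(n-k,k)}`
    (∃ P : MvPolynomial (Fin (m + 1)) ℂ, P ≠ 0 ∧
      ∀ b : ℕ → ℂ, MvPolynomial.eval (fun i : Fin (m + 1) => b i) P ≠ 0 →
        Set.InjOn (fun k => eigval n m k b) (Set.Iic m) ∧
        ∀ k ≤ m,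
          Module.finrank ℂ (Module.End.eigenspace (Matrix.toLin' (intertwiner n m b))
            (eigval n m k b)) = spechtDim n k ∧
          (intertwiner n m b).charpoly.rootMultiplicity (eigval n m k b) = spechtDim n k) ∧
    -- for every `b`, multiplicities add up when eigenvalues coincide; there are no others
    (∀ b : ℕ → ℂ,
      (intertwiner n m b).charpoly =
        ∏ k ∈ Finset.range (m + 1),
          (Polynomial.X - Polynomial.C (eigval n m k b)) ^ spechtDim n k ∧
      ∀ k ≤ m,
        Module.finrank ℂ (Module.End.eigenspace (Matrix.toLin' (intertwiner n m b))
          (eigval n m k b)) =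
        ∑ l ∈ Finset.range (m + 1) with eigval n m l b = eigval n m k b, spechtDim n l) ∧
    -- the value of `f^{(n-k,k)}`
    (∀ k ≤ m,
      (spechtDim n k : ℚ) =
        (n.factorial : ℚ) * ((n : ℚ) - 2 * k + 1) /
          ((k.factorial : ℚ) * ((n - k + 1).factorial : ℚ)) ∧
      (spechtDim n k : ℤ) =
        (n.choose k : ℤ) - (if k = 0 then 0 else (n.choose (k - 1) : ℤ))) := by
  have : NeZero n := ⟨hn.ne'⟩
  have hmn : m ≤ n := by omega
  have h2m : 2 * m ≤ n := by omega
  refine ⟨fun b k hk => ?_, ?_, fun b => ⟨charpoly_intertwiner h2m b, fun k _ =>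
    finrank_eigenspace_intertwiner h2m b _⟩, fun k hk =>
    ⟨spechtDim_eq_div (by omega), spechtDim_eq_sub (by omega)⟩⟩
  · rw [Module.End.hasEigenvector_iff, Module.End.mem_eigenspace_iff, Matrix.toLin'_apply]
    exact ⟨intertwiner_mulVec_proj_youngSymm hk hmn (by omega) b,
      proj_youngSymm_ne_zero hk hmn (by omega)⟩
  · obtain ⟨P, hP, hinj⟩ := exists_generic_polynomial h2m
    refine ⟨P, hP, fun b hb => ⟨hinj b hb, fun k hk => ⟨?_, ?_⟩⟩⟩
    · rw [finrank_eigenspace_intertwiner h2m b, Finset.sum_eq_single_of_mem k]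
      · exact Finset.mem_filter.2 ⟨Finset.mem_range.2 (by omega), rfl⟩
      · intro l hl hlk
        obtain ⟨hl, hl'⟩ := Finset.mem_filter.1 hl
        exact absurd (hinj b hb (Nat.lt_succ_iff.1 (Finset.mem_range.1 hl)) hk hl') hlk
    · rw [charpoly_intertwiner h2m b, ← Polynomial.count_roots, Polynomial.roots_prod _ _
        (Finset.prod_ne_zero_iff.2 fun l _ => pow_ne_zero _ (Polynomial.X_sub_C_ne_zero _)),
        Multiset.count_bind]
      simp only [Polynomial.roots_pow, Polynomial.roots_X_sub_C, Multiset.count_nsmul,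
        Multiset.count_singleton]
      -- As the `λ_l` are distinct, `λ_k` is a root of the factor with index `k` only.
      rw [Finset.sum_map_val, Finset.sum_eq_single_of_mem k (Finset.mem_range.2 (by omega))]
      · simp
      · intro l hl hlk
        rw [if_neg, mul_zero]
        exact fun h => hlk (hinj b hb hk (Nat.lt_succ_iff.1 (Finset.mem_range.1 hl)) h).symm
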